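/- **Setting.** Let $\mathcal X$ be a non-empty set, $\mathcal Y$ a set with at least two elements, $\mathcal Z=\mathcal X\times\mathcal Y$ equipped with a $\sigma$-algebra containing all singletons, and let $\mathcal H$ be a non-empty set of functions $\mathcal X\to\mathcal Y$. For a probability measure $\mathcal D$ on $\mathcal Z$ and a sample $S=((x_1,y_1),\dots,(x_m,y_m))\in\mathcal Z^m$ put $$L_{\mathcal D}(h)=\Pr_{(x,y)\sim\mathcal D}[h(x)\ne y],\qquad L_S(h)=\frac1m\,\bigl|\{i : h(x_i)\ne y_i\}\bigr|$$ (with $L_S(h)=0$ if $m=0$). A *distribution* means a probability measure $\mathcal D$ on $\mathcal Z$ with respect to which $\mathcal H$ is well behaved: the sets $\{(x,y): h(x)\neq y\}$, $h\in\mathcal H$, are measurable up to $\mathcal D$-null sets, and, for all $m\in\mathbb N$ and $t\in\mathbb R$, so is (with respect to $\mathcal D^m\times\mathcal D^m$) the set of pairs $(S,S')\in\mathcal Z^m\times\mathcal Z^m$ for which some $h\in\mathcal H$ has $|L_S(h)-L_{S'}(h)|>t$. (Every discrete probability measure qualifies.) For $\epsilon,\delta\in(0,1)$ let $d^{UC}(\epsilon,\delta)\in\mathbb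 N\cup\{\infty\}$ be the least $N\in\mathbb N$ such that for every distribution $\mathcal D$ and every $m\ge N$, with probability at least $1-\delta$ over $S\sim\mathcal D^m$, $$\forall h\in\mathcal H\quad |L_{\mathcal D}(h)-L_S(h)|\le\epsilon$$ (i.e. the complementary event has outer probability at most $\delta$), and $\infty$ if there is no such $N$. For $f:\mathcal X\to\mathcal Y$ and $h\in\mathcal H$ let $h_f:\mathcal X\to\{0,1\}$ be $0$ where $h=f$ and $1$ elsewhere, and $\mathcal H_f=\{h_f:h\in\mathcal H\}$. The graph dimension of $\mathcal H$ is $d=\dim_G(\mathcal H)=\sup_{f\in\mathcal Y^{\mathcal X}}VC(\mathcal H_f)\in\mathbb N\cup\{\infty\}$, where $VC$ is the VC dimension. **Theorem 3.6.** For every $c\in(0,1)$ there are constants $C_1,C_2>0$, depending only on $c$ (and not on $\mathcal X,\mathcal Y,\mathcal H,\epsilon,\delta$), such that for all $\mathcal X,\mathcal Y,\mathcal H$ as above and all $\epsilon,\delta\in(0,c]$: if $d<\infty$ then $d^{UC}(\epsilon,\delta)<\infty$ and $$C_1\cdot\frac{d+\log(1/\delta)-C_1}{\epsilon^2}\;\le\;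 d^{UC}(\epsilon,\delta)\;\le\; C_2\cdot\frac{d\log(1/\epsilon)+\log(1/\delta)}{\epsilon^2},$$ and if $d=\infty$ then $d^{UC}(\epsilon,\delta)=\infty$. -/

import Mathlib

open MeasureTheory

noncomputable section

namespace Multiclass

variable {X Y : Type*}

/-- The zero/one loss of the hypothesis `h` on the labelled example `z = (x, y)`. -/
def zeroOneLoss (h : X → Y) (z : X × Y) : ℝ :=
  open Classical in if h z.1 = z.2 then 0 else 1

/-- The risk `L_D(h)`: the expected loss of `h` under the distribution `D`. -/
def risk [MeasurableSpace (X × Y)] (D : Measure (X × Y)) (h : X → Y) : ℝ :=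
  ∫ z, zeroOneLoss h z ∂D

/-- The empirical risk `L_S(h)` on a sample `S` of `m` examples
(for the empty sample this is the empty average `0`). -/
def empiricalRisk {m : ℕ} (S : Fin m → X × Y) (h : X → Y) : ℝ :=
  (1 / (m : ℝ)) * ∑ i, zeroOneLoss h (S i)

/-- The law `D^m` of a sample of `m` independent examples drawn from `D`. -/
def sampleLaw [MeasurableSpace (X × Y)] (D : Measure (X × Y)) (m : ℕ) :
    Measure (Fin m → X × Y) :=
  Measure.pi fun _ => D

/-- `H` is well behaved with respect to `D` (the usual measurability proviso): up to null sets, the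
losses of the hypotheses in `H` are measurable, and so are the events that, on two independent
samples of the same size, some hypothesis in `H` has empirical risks differing by more than `t`.
This holds for every `D` concentrated on a countable set (if points are measurable), and for
countable `H` as soon as the losses are measurable. -/
structure WellBehaved [MeasurableSpace (X × Y)] (H : Set (X → Y)) (D : Measure (X × Y)) :
    Prop where
  loss : ∀ h ∈ H, NullMeasurableSet {z : X × Y | h z.1 ≠ z.2} D
  deviation : ∀ (m : ℕ) (t : ℝ), NullMeasurableSet
    {P : (Fin m → X × Y) × (Fin m → X × Y) |
      ∃ h ∈ H, t < |empiricalRisk P.1 h - empiricalRisk P.2 h|}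
    ((sampleLaw D m).prod (sampleLaw D m))

/-- `N` is a uniform convergence sample size for `(ε, δ)`: for every distribution `D` and every
`m ≥ N`, with probability at least `1 - δ` over `S ∼ D^m`, all `h ∈ H` satisfy
`|L_D(h) - L_S(h)| ≤ ε`. This is expressed by the complementary event having (outer) probability
at most `δ`. -/
def IsUCSampleSize [MeasurableSpace (X × Y)] (H : Set (X → Y)) (ε δ : ℝ) (N : ℕ) : Prop :=
  ∀ (D : Measure (X × Y)) [IsProbabilityMeasure D], WellBehaved H D → ∀ m : ℕ, N ≤ m →
    sampleLaw D m {S | ¬ ∀ h ∈ H, |risk D h - empiricalRisk S h| ≤ ε} ≤ ENNReal.ofReal δ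

/-- The uniform convergence rate `d^{UC}(ε, δ)` of `H`: the least uniform convergence sample size,
`⊤` if there is none. -/
def ucRate [MeasurableSpace (X × Y)] (H : Set (X → Y)) (ε δ : ℝ) : ℕ∞ :=
  ⨅ (N : ℕ) (_ : IsUCSampleSize H ε δ N), (N : ℕ∞)

/-- The finite set `A` is shattered by the class `F` of `{0,1}`-valued functions. -/
def Shatters (F : Set (X → Fin 2)) (A : Finset X) : Prop :=
  ∀ b : X → Fin 2, ∃ g ∈ F, ∀ x ∈ A, g x = b x

/-- The VC dimension of `F`: the supremum of the sizes of the finite sets it shatters. -/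
def vcDim (F : Set (X → Fin 2)) : ℕ∞ :=
  ⨆ (A : Finset X) (_ : Shatters F A), (A.card : ℕ∞)

/-- The function `h_f : X → {0,1}`, with `h_f x = 0` exactly when `h x = f x`. -/
def disagreement (f h : X → Y) (x : X) : Fin 2 :=
  open Classical in if h x = f x then 0 else 1

/-- The graph dimension of `H`: the supremum over all `f : X → Y` of the VC dimension of
`H_f = {h_f : h ∈ H}`. -/
def graphDim (H : Set (X → Y)) : ℕ∞ :=
  ⨆ f : X → Y, vcDim (disagreement f '' H)

end Multiclass

end

/-!
# Rates of uniform convergence for multiclass learning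

The bounds on `ucRate` come from three facts about uniform convergence sample sizes `N`.

**Lower bounds.** Every law used here is that of `g ω` for a uniformly random element `ω` of a
finite type. All sets are null measurable for such a law, so it is well behaved, and the
probability of a bad sample is a proportion of a finite set (`IsUCSampleSize.card_le`).

* A single hypothesis turns the labels into a coin. For small `ε`, a block of `b ≈ κ / ε ^ 2` fair
  coins deviates by more than `ε` with probability greater than `c`, because each value of the sum
  has probability at most the central binomial one, of order `1 / √b`. A sample made of `l` blocks
  that all deviate upwards deviates too, which has probability at least `(c / 2) ^ l`. For `ε`
  bounded below, a biased coin that shows the same side throughout suffices. Together these give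
  `N ≥ k * log (1 / δ) / ε ^ 2` (`exists_mul_log_div_sq_le`).
* On a shattered set `A` every pattern of errors occurs. Split `A` into `k` pairs with the uniform
  law, and let a hypothesis err on the more frequent point of each pair: its empirical risk exceeds
  its risk by `(∑ j, |R j|) / (2 * m)`, where `R j` is the difference of the two counts. The second
  moment method applied to `∑ j, R j ^ 2`, with Markov's inequality for `∑ j, R j ^ 4`, shows that
  `∑ j, |R j|` is of order `√(k * m)` with probability close to `1` when `k` is large. For `ε`
  bounded below, let a hypothesis err exactly off the sample; this also settles infinite graph
  dimension. For bounded `|A|` the coin suffices. Together these give `N ≥ k * |A| / ε ^ 2`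
  (`exists_mul_card_div_sq_le`).

**Upper bound.** This is the argument of Vapnik and Chervonenkis. A bad sample deviates from an
independent second one with probability at least `1 / 2` (`sampleLaw_not_uniform_le`); the law of
the pair is invariant under exchanging corresponding examples, and for a fixed pair a random
exchange produces a deviation with small probability, by Hoeffding's inequality and a union bound
over the error patterns on the `2 * m` examples (`card_swapAt_deviation_le`). Examples on which all
error patterns occur have distinct instances, so the graph dimension bounds the VC dimension of the
patterns, and the Sauer–Shelah lemma their number (`pow_mul_card_errorPatterns_le`).
-/

noncomputable section

namespace Multiclass

variable {X Y : Type*}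

/-! ### Uniform laws on finite types -/

theorem aestronglyMeasurable_zeroOneLoss [MeasurableSpace (X × Y)] {D : Measure (X × Y)}
    {h : X → Y} (hh : NullMeasurableSet {z : X × Y | h z.1 ≠ z.2} D) :
    AEStronglyMeasurable (zeroOneLoss h) D := by
  have : zeroOneLoss h = Set.indicator {z : X × Y | h z.1 ≠ z.2} (fun _ => (1 : ℝ)) := by
    funext z
    by_cases hz : h z.1 = z.2 <;> simp [zeroOneLoss, hz]
  rw [this]
  exact (aemeasurable_const.indicator₀ hh).aestronglyMeasurable

theorem zeroOneLoss_mem_Icc (h : X → Y) (z : X × Y) : zeroOneLoss h z ∈ Set.Icc (0 : ℝ) 1 := by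
  unfold zeroOneLoss
  split_ifs <;> simp

/-- The law of a random variable on a countable discrete space is concentrated on a countable set,
so that every set is null measurable. -/
theorem nullMeasurableSet_map_of_countable {Ω Z : Type*} [Countable Ω] [MeasurableSpace Ω]
    [DiscreteMeasurableSpace Ω] [MeasurableSpace Z] [MeasurableSingletonClass Z]
    (μ : Measure Ω) (f : Ω → Z) (s : Set Z) : NullMeasurableSet s (μ.map f) := by
  have hr : (Set.range f).Countable := Set.countable_range f
  have h : (s ∩ Set.range f : Set Z) =ᵐ[μ.map f] s := by
    have h0 : ∀ᵐ z ∂μ.map f, z ∈ Set.range f := by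
      refine (ae_map_iff (p := fun z => z ∈ Set.range f)
        (measurable_of_countable f).aemeasurable hr.measurableSet).2 ?_
      exact Filter.Eventually.of_forall fun x => ⟨x, rfl⟩
    filter_upwards [h0] with z hz
    exact propext ⟨fun h => h.1, fun h => ⟨h, hz⟩⟩
  exact (hr.mono Set.inter_subset_right).measurableSet.nullMeasurableSet.congr h

/-- The uniform probability measure on a finite type. -/
def unif (Ω : Type) [Fintype Ω] [Nonempty Ω] [MeasurableSpace Ω] : Measure Ω :=
  (PMF.uniformOfFintype Ω).toMeasure

instance (Ω : Type) [Fintype Ω] [Nonempty Ω] [MeasurableSpace Ω] :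
    IsProbabilityMeasure (unif Ω) := by unfold unif; infer_instance

theorem unif_singleton (Ω : Type) [Fintype Ω] [Nonempty Ω] [MeasurableSpace Ω]
    [DiscreteMeasurableSpace Ω] (x : Ω) : unif Ω {x} = (Fintype.card Ω : ENNReal)⁻¹ := by
  unfold unif
  rw [PMF.toMeasure_apply_singleton _ _ (MeasurableSet.of_discrete)]
  simp

theorem integral_unif (Ω : Type) [Fintype Ω] [Nonempty Ω] [MeasurableSpace Ω]
    [DiscreteMeasurableSpace Ω] (F : Ω → ℝ) :
    ∫ x, F x ∂unif Ω = (∑ x, F x) / Fintype.card Ω := by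
  rw [integral_fintype (Integrable.of_finite)]
  simp [Measure.real, unif_singleton, Finset.mul_sum, div_eq_inv_mul]

theorem pi_unif_apply (Ω : Type) [Fintype Ω] [Nonempty Ω] [MeasurableSpace Ω]
    [DiscreteMeasurableSpace Ω] (m : ℕ) (B : Finset (Fin m → Ω)) :
    Measure.pi (fun _ : Fin m => unif Ω) (B : Set (Fin m → Ω)) =
      B.card * ((Fintype.card Ω : ENNReal)⁻¹) ^ m := by
  rw [← sum_measure_singleton]
  simp [unif_singleton]

/-- The law of `g ω` for a uniformly random element `ω` of a finite type. -/
def uniformLaw {Ω : Type} [Fintype Ω] [Nonempty Ω] [MeasurableSpace Ω]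
    [MeasurableSpace (X × Y)] (g : Ω → X × Y) : Measure (X × Y) :=
  (unif Ω).map g

section

variable {Ω : Type} [Fintype Ω] [Nonempty Ω] [MeasurableSpace Ω] [DiscreteMeasurableSpace Ω]
  [MeasurableSpace (X × Y)]

instance (g : Ω → X × Y) : IsProbabilityMeasure (uniformLaw g) :=
  Measure.isProbabilityMeasure_map (measurable_of_countable g).aemeasurable

theorem sampleLaw_uniformLaw (g : Ω → X × Y) (m : ℕ) :
    sampleLaw (uniformLaw g) m =
      (Measure.pi fun _ : Fin m => unif Ω).map (fun ω i => g (ω i)) := by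
  unfold sampleLaw uniformLaw
  rw [Measure.pi_map_pi (fun _ => (measurable_of_countable g).aemeasurable)]

variable [MeasurableSingletonClass (X × Y)]

theorem wellBehaved_uniformLaw (H : Set (X → Y)) (g : Ω → X × Y) :
    WellBehaved H (uniformLaw g) := by
  refine ⟨fun h _ => nullMeasurableSet_map_of_countable _ _ _, fun m t => ?_⟩
  rw [sampleLaw_uniformLaw, Measure.map_prod_map _ _ (measurable_of_countable _)
    (measurable_of_countable _)]
  exact nullMeasurableSet_map_of_countable _ _ _

theorem risk_uniformLaw (g : Ω → X × Y) (h : X → Y) :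
    risk (uniformLaw g) h = (∑ ω, zeroOneLoss h (g ω)) / Fintype.card Ω := by
  unfold risk uniformLaw
  have hs : AEStronglyMeasurable (zeroOneLoss h) ((unif Ω).map g) :=
    aestronglyMeasurable_zeroOneLoss (nullMeasurableSet_map_of_countable _ _ _)
  rw [integral_map (measurable_of_countable g).aemeasurable hs, integral_unif]

/-- Lower bounds on the uniform convergence rate reduce to counting: under a uniform law on a
finite type, at most a fraction `δ` of the samples may be bad. -/
theorem IsUCSampleSize.card_le {H : Set (X → Y)} {ε δ : ℝ} {N m : ℕ}
    (hN : IsUCSampleSize H ε δ N) (hδ : 0 ≤ δ) (hm : N ≤ m) (g : Ω → X × Y)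
    (B : Finset (Fin m → Ω))
    (hB : ∀ ω ∈ B, ∃ h ∈ H, ε < |(∑ x, zeroOneLoss h (g x)) / Fintype.card Ω -
      (1 / (m : ℝ)) * ∑ i, zeroOneLoss h (g (ω i))|) :
    (B.card : ℝ) ≤ δ * (Fintype.card Ω : ℝ) ^ m := by
  have h1 := hN (uniformLaw g) (wellBehaved_uniformLaw H g) m hm
  rw [sampleLaw_uniformLaw] at h1
  have h2 := (Measure.le_map_apply (measurable_of_countable _).aemeasurable _).trans h1
  have h3 : (B : Set (Fin m → Ω)) ⊆ (fun (ω : Fin m → Ω) i => g (ω i)) ⁻¹'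
      {S | ¬ ∀ h ∈ H, |risk (uniformLaw g) h - empiricalRisk S h| ≤ ε} := by
    intro ω hω
    obtain ⟨h, hh, hlt⟩ := hB ω hω
    simp only [Set.mem_preimage, Set.mem_ofPred_eq, not_forall]
    refine ⟨h, hh, ?_⟩
    rw [not_le, risk_uniformLaw]
    exact hlt
  have h4 := (measure_mono h3).trans h2
  rw [pi_unif_apply] at h4
  have hc : (0 : ℝ) < Fintype.card Ω := by exact_mod_cast Fintype.card_pos
  have h5 := ENNReal.toReal_mono ENNReal.ofReal_ne_top h4
  rw [ENNReal.toReal_ofReal hδ] at h5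
  simp only [ENNReal.toReal_mul, ENNReal.toReal_natCast, ENNReal.toReal_pow,
    ENNReal.toReal_inv] at h5
  rw [inv_pow, ← div_eq_mul_inv, div_le_iff₀ (by positivity)] at h5
  exact h5

end

/-! ### The lower bound from a coin -/

theorem exists_loss_zero_one [Nonempty X] [Nontrivial Y] (h : X → Y) :
    ∃ z₀ z₁ : X × Y, zeroOneLoss h z₀ = 0 ∧ zeroOneLoss h z₁ = 1 := by
  obtain ⟨x⟩ := ‹Nonempty X›
  obtain ⟨y, hy⟩ := exists_ne (h x)
  exact ⟨(x, h x), (x, y), by simp [zeroOneLoss], by simp [zeroOneLoss, hy.symm]⟩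

/-- The bound for large `ε`: a coin of bias `K / (K + 1) > ε` shows tails
`N` times with probability `(K + 1) ^ (-N)`, and then its empirical mean is `0`. -/
theorem IsUCSampleSize.one_le_mul_pow [Nonempty X] [Nontrivial Y] [MeasurableSpace (X × Y)]
    [MeasurableSingletonClass (X × Y)] {H : Set (X → Y)} (hH : H.Nonempty) {ε δ : ℝ} {N : ℕ}
    (hN : IsUCSampleSize H ε δ N) (hδ : 0 ≤ δ) (K : ℕ) (hK : ε < K / (K + 1)) :
    1 ≤ δ * ((K : ℝ) + 1) ^ N := by
  obtain ⟨h, hh⟩ := hH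
  obtain ⟨z₀, z₁, h0, h1⟩ := exists_loss_zero_one h
  have := hN.card_le hδ le_rfl (Ω := Fin (K + 1)) (fun i => if i = 0 then z₀ else z₁)
    {fun _ => 0} (by
      intro ω hω
      rw [Finset.mem_singleton] at hω
      subst hω
      refine ⟨h, hh, lt_of_lt_of_le hK ?_⟩
      rw [Fin.sum_univ_succ]
      simp [h0, h1, Fin.succ_ne_zero]
      exact le_abs_self _)
  simpa using this

theorem centralBinom_sq_mul_le (n : ℕ) : n.centralBinom ^ 2 * (2 * n + 1) ≤ 16 ^ n := by
  induction n with
  | zero => simp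
  | succ n ih =>
    have h := Nat.succ_mul_centralBinom_succ n
    have h2 : (n + 1) ^ 2 * ((n + 1).centralBinom ^ 2 * (2 * (n + 1) + 1)) ≤
        (n + 1) ^ 2 * 16 ^ (n + 1) := by
      calc (n + 1) ^ 2 * ((n + 1).centralBinom ^ 2 * (2 * (n + 1) + 1))
          = ((n + 1) * (n + 1).centralBinom) ^ 2 * (2 * n + 3) := by ring
        _ = 4 * ((2 * n + 1) * (2 * n + 3)) * (n.centralBinom ^ 2 * (2 * n + 1)) := by
            rw [h]; ring
        _ ≤ 4 * (4 * (n + 1) ^ 2) * 16 ^ n := by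
            have : (2 * n + 1) * (2 * n + 3) ≤ 4 * (n + 1) ^ 2 := by nlinarith
            exact Nat.mul_le_mul (Nat.mul_le_mul_left 4 this) ih
        _ = _ := by ring
    exact Nat.le_of_mul_le_mul_left h2 (by positivity)

/-- The centred value `± 1 / 2` of a fair coin. -/
def coin (s : Bool) : ℝ := if s then 1 / 2 else -(1 / 2)

theorem sum_coin {n : ℕ} (ω : Fin n → Bool) :
    ∑ i, coin (ω i) = (Finset.univ.filter fun i => ω i = true).card - (n : ℝ) / 2 := by
  have : ∀ i, coin (ω i) = (if ω i = true then 1 else 0) - 1 / 2 := by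
    intro i
    unfold coin
    split_ifs <;> norm_num
  simp_rw [this]
  rw [Finset.sum_sub_distrib, Finset.sum_boole]
  simp
  ring

theorem card_filter_card_eq (n j : ℕ) :
    (Finset.univ.filter fun ω : Fin n → Bool =>
      (Finset.univ.filter fun i => ω i = true).card = j).card ≤ n.choose j := by
  have h : (Finset.powersetCard j (Finset.univ : Finset (Fin n))).card = n.choose j := by simp
  rw [← h]
  refine Finset.card_le_card_of_injOn (fun ω => Finset.univ.filter fun i => ω i = true) ?_ ?_
  · intro ω hω
    simpa [Finset.mem_powersetCard] using hω
  · intro ω _ ω' _ he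
    funext i
    have := Finset.ext_iff.1 he i
    simpa only [Finset.mem_filter, Finset.mem_univ, true_and, ← Bool.eq_iff_iff] using this

theorem card_filter_abs_sub_le (n : ℕ) (r s : ℝ) (hs : 0 ≤ s) :
    (((Finset.range n).filter fun j : ℕ => |(j : ℝ) - r| ≤ s).card : ℝ) ≤ 2 * s + 1 := by
  have h : (Finset.range n).filter (fun j : ℕ => |(j : ℝ) - r| ≤ s) ⊆
      Finset.Icc ⌈r - s⌉₊ ⌊r + s⌋₊ := by
    intro j hj
    rw [Finset.mem_filter, abs_le] at hj
    rw [Finset.mem_Icc]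
    exact ⟨Nat.ceil_le.2 (by linarith), Nat.le_floor (by linarith)⟩
  have h2 := Finset.card_le_card h
  rw [Nat.card_Icc] at h2
  refine (Nat.cast_le.2 h2).trans ?_
  rcases le_total ⌈r - s⌉₊ (⌊r + s⌋₊ + 1) with hle | hle
  · rw [Nat.cast_sub hle]
    push_cast
    have h3 := Nat.le_ceil (r - s)
    rcases le_total 0 (r + s) with h0 | h0
    · have := Nat.floor_le h0
      linarith
    · have : ⌊r + s⌋₊ = 0 := Nat.floor_of_nonpos h0
      rw [this]
      have : (0 : ℝ) ≤ (⌈r - s⌉₊ : ℝ) := by positivity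
      push_cast
      linarith
  · rw [Nat.sub_eq_zero_of_le hle]
    push_cast
    linarith

/-- Small ball estimate for a sum of fair coins, from the size of the central binomial
coefficient. -/
theorem card_abs_sum_coin_le (r : ℕ) (s : ℝ) (hs : 0 ≤ s) :
    ((Finset.univ.filter fun ω : Fin (2 * r) → Bool => |∑ i, coin (ω i)| ≤ s).card : ℝ) ≤
      (2 * s + 1) * r.centralBinom := by
  classical
  set J := (Finset.range (2 * r + 1)).filter fun j : ℕ => |(j : ℝ) - r| ≤ s with hJ
  have hmaps : ∀ ω ∈ (Finset.univ.filter fun ω : Fin (2 * r) → Bool => |∑ i, coin (ω i)| ≤ s),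
      (Finset.univ.filter fun i => ω i = true).card ∈ J := by
    intro ω hω
    rw [Finset.mem_filter, sum_coin] at hω
    rw [hJ, Finset.mem_filter, Finset.mem_range]
    refine ⟨Nat.lt_succ_of_le ?_, ?_⟩
    · simpa using Finset.card_le_univ (Finset.univ.filter fun i => ω i = true)
    · have := hω.2
      push_cast at this
      rwa [mul_div_cancel_left₀ _ (two_ne_zero)] at this
  have h1 := Finset.card_eq_sum_card_fiberwise hmaps
  have h2 : (Finset.univ.filter fun ω : Fin (2 * r) → Bool => |∑ i, coin (ω i)| ≤ s).card ≤
      J.card * r.centralBinom := by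
    rw [h1]
    refine Finset.sum_le_card_nsmul _ _ _ fun j _ => ?_
    calc _ ≤ (Finset.univ.filter fun ω : Fin (2 * r) → Bool =>
          (Finset.univ.filter fun i => ω i = true).card = j).card :=
          Finset.card_le_card fun ω hω => by
            simp only [Finset.mem_filter] at hω ⊢
            exact ⟨Finset.mem_univ _, hω.2⟩
      _ ≤ _ := card_filter_card_eq _ _
      _ ≤ _ := Nat.choose_le_centralBinom _ _
  calc _ ≤ ((J.card * r.centralBinom : ℕ) : ℝ) := Nat.cast_le.2 h2
    _ = (J.card : ℝ) * r.centralBinom := by push_cast; rfl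
    _ ≤ _ := by
      gcongr
      exact card_filter_abs_sub_le _ _ _ hs

theorem centralBinom_mul_sqrt_le (r : ℕ) :
    (r.centralBinom : ℝ) * √(2 * r + 1) ≤ 4 ^ r := by
  have h : ((r.centralBinom ^ 2 * (2 * r + 1) : ℕ) : ℝ) ≤ ((16 ^ r : ℕ) : ℝ) :=
    Nat.cast_le.2 (centralBinom_sq_mul_le r)
  push_cast at h
  refine abs_le_of_sq_le_sq' ?_ (by positivity) |>.2
  rw [mul_pow, Real.sq_sqrt (by positivity), ← pow_mul, mul_comm r 2, pow_mul]
  norm_num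
  exact h

/-- The samples whose sum of values of `a` exceeds `t`. -/
def upperTail {Ω : Type} [Fintype Ω] (a : Ω → ℝ) (n : ℕ) (t : ℝ) : Finset (Fin n → Ω) :=
  open Classical in Finset.univ.filter fun ω => t < ∑ i, a (ω i)

theorem mem_upperTail {Ω : Type} [Fintype Ω] {a : Ω → ℝ} {n : ℕ} {t : ℝ} {ω : Fin n → Ω} :
    ω ∈ upperTail a n t ↔ t < ∑ i, a (ω i) := by
  simp [upperTail]

theorem card_upperTail_mul_le {Ω : Type} [Fintype Ω] (a : Ω → ℝ) (n n' : ℕ) (t t' : ℝ) :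
    (upperTail a n t).card * (upperTail a n' t').card ≤
      (upperTail a (n + n') (t + t')).card := by
  rw [← Finset.card_product]
  refine Finset.card_le_card_of_injOn (fun p => Fin.append p.1 p.2) ?_ ?_
  · rintro ⟨u, v⟩ h
    rw [Finset.mem_coe, Finset.mem_product, mem_upperTail, mem_upperTail] at h
    rw [Finset.mem_coe, mem_upperTail, Fin.sum_univ_add]
    simp only [Fin.append_left, Fin.append_right]
    exact add_lt_add h.1 h.2
  · intro p _ q _ h
    exact (Fin.appendEquiv n n').injective h

theorem pow_card_upperTail_le {Ω : Type} [Fintype Ω] (a : Ω → ℝ) (n : ℕ) (t : ℝ) (l : ℕ) :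
    (upperTail a n t).card ^ (l + 1) ≤ (upperTail a ((l + 1) * n) ((l + 1 : ℕ) * t)).card := by
  induction l with
  | zero =>
    have h1 : (0 + 1) * n = n := by ring
    rw [h1]
    simp
  | succ l ih =>
    have h1 : (l + 1 + 1) * n = (l + 1) * n + n := by ring
    have h2 : ((l + 1 + 1 : ℕ) : ℝ) * t = (l + 1 : ℕ) * t + t := by push_cast; ring
    rw [pow_succ, h1, h2]
    exact (Nat.mul_le_mul_right _ ih).trans (card_upperTail_mul_le a _ _ _ _)

theorem card_lowerTail_coin (n : ℕ) (t : ℝ) :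
    (Finset.univ.filter fun ω : Fin n → Bool => ∑ i, coin (ω i) < -t).card =
      (upperTail coin n t).card := by
  classical
  have hneg : ∀ b, coin (!b) = -coin b := by intro b; cases b <;> simp [coin]
  refine Finset.card_bij (fun ω _ i => !ω i) ?_ ?_ ?_
  · intro ω hω
    rw [Finset.mem_filter] at hω
    rw [mem_upperTail]
    simp only [hneg, Finset.sum_neg_distrib]
    linarith [hω.2]
  · intro ω _ ω' _ h
    funext i
    simpa using congrFun h i
  · intro ω hω
    rw [mem_upperTail] at hω
    refine ⟨fun i => !ω i, ?_, by simp⟩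
    rw [Finset.mem_filter]
    simp only [hneg, Finset.sum_neg_distrib]
    exact ⟨Finset.mem_univ _, by linarith⟩

/-- Some tail of a sum of `2 r` coins is heavy once the small ball estimate is nontrivial. -/
theorem lt_card_upperTail_coin (r : ℕ) (ε c : ℝ) (hε : 0 ≤ ε)
    (h : 4 * r * ε + 1 < (1 - c) * √(2 * r + 1)) (hc : c < 1) :
    c * 2 ^ (2 * r) < 2 * ((upperTail coin (2 * r) ((2 * r : ℕ) * ε)).card : ℝ) := by
  classical
  have h1 := card_abs_sum_coin_le r ((2 * r : ℕ) * ε) (by positivity)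
  set s := ((2 * r : ℕ) : ℝ) * ε with hs
  have h2 := centralBinom_mul_sqrt_le r
  have hcb : (0 : ℝ) < r.centralBinom := by exact_mod_cast r.centralBinom_pos
  have h3 : (2 * s + 1) * r.centralBinom < (1 - c) * 4 ^ r := by
    calc (2 * s + 1) * r.centralBinom = (4 * r * ε + 1) * r.centralBinom := by
          rw [hs]; push_cast; ring
      _ < (1 - c) * √(2 * r + 1) * r.centralBinom := by gcongr
      _ = (1 - c) * (r.centralBinom * √(2 * r + 1)) := by ring
      _ ≤ _ := by
        have : 0 ≤ 1 - c := by linarith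
        gcongr
  have h4 : (Finset.univ : Finset (Fin (2 * r) → Bool)) ⊆
      (Finset.univ.filter fun ω : Fin (2 * r) → Bool => |∑ i, coin (ω i)| ≤ s) ∪
      ((Finset.univ.filter fun ω : Fin (2 * r) → Bool => ∑ i, coin (ω i) < -s) ∪
        upperTail coin (2 * r) s) := by
    intro ω _
    simp only [Finset.mem_union, Finset.mem_filter, Finset.mem_univ, true_and, mem_upperTail,
      abs_le]
    by_contra hcon
    push Not at hcon
    exact absurd (hcon.1 hcon.2.1) (not_lt.2 hcon.2.2)
  have h5 := (Finset.card_le_card h4).trans ((Finset.card_union_le _ _).trans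
    (Nat.add_le_add_left (Finset.card_union_le _ _) _))
  rw [card_lowerTail_coin] at h5
  have h6 : ((2 ^ (2 * r) : ℕ) : ℝ) ≤ _ := Nat.cast_le.2 (by simpa using h5)
  push_cast at h6
  have h7 : (2 : ℝ) ^ (2 * r) = 4 ^ r := by rw [pow_mul]; norm_num
  rw [h7] at h6 ⊢
  nlinarith

section

variable [Nonempty X] [Nontrivial Y] [MeasurableSpace (X × Y)]
  [MeasurableSingletonClass (X × Y)] {H : Set (X → Y)}

theorem IsUCSampleSize.card_abs_sum_coin_le (hH : H.Nonempty) {ε δ : ℝ} {N m : ℕ}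
    (hN : IsUCSampleSize H ε δ N) (hδ : 0 ≤ δ) (hm : N ≤ m) (h0 : 0 < m)
    (B : Finset (Fin m → Bool)) (hB : ∀ ω ∈ B, m * ε < |∑ i, coin (ω i)|) :
    (B.card : ℝ) ≤ δ * 2 ^ m := by
  obtain ⟨h, hh⟩ := hH
  obtain ⟨z₀, z₁, hz0, hz1⟩ := exists_loss_zero_one h
  have := hN.card_le hδ hm (Ω := Bool) (fun b => if b then z₁ else z₀) B (by
    intro ω hω
    refine ⟨h, hh, ?_⟩
    have h1 : ∀ b : Bool, zeroOneLoss h (if b then z₁ else z₀) = coin b + 1 / 2 := by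
      intro b
      cases b <;> simp [hz0, hz1, coin]
      norm_num
    have hm' : (0 : ℝ) < m := by exact_mod_cast h0
    simp_rw [h1]
    rw [Finset.sum_add_distrib, Finset.sum_add_distrib]
    have h2 : (∑ x, coin x + ∑ _x : Bool, (1 / 2 : ℝ)) / (Fintype.card Bool : ℝ) -
        1 / (m : ℝ) * (∑ i, coin (ω i) + ∑ _i : Fin m, (1 / 2 : ℝ)) =
        -((∑ i, coin (ω i)) / m) := by
      simp [coin]
      field_simp
      ring
    rw [h2, abs_neg, abs_div, abs_of_pos hm', lt_div_iff₀ hm', mul_comm]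
    exact hB ω hω)
  simpa using this

/-- The fair coin forces `N ≥ b * log (1 / δ) / (2 * log (2 / c))` for even `b = 2 * r` such that
the deviation of `b` coins exceeds `ε` with probability more than `c`: a sample of `l * b` coins
has a large mean if each of its `l` blocks has. -/
theorem IsUCSampleSize.mul_log_le_of_coin (hH : H.Nonempty) {c ε δ : ℝ} {N : ℕ} (hc0 : 0 < c)
    (hc1 : c < 1) (hε : 0 ≤ ε) (hδ : 0 < δ) (hδc : δ ≤ c) (hN : IsUCSampleSize H ε δ N) (r : ℕ)
    (hr : 0 < r) (h : 4 * r * ε + 1 < (1 - c) * √(2 * r + 1)) :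
    (2 * r : ℝ) * Real.log (1 / δ) ≤ N * (2 * Real.log (2 / c)) := by
  classical
  have ht := lt_card_upperTail_coin r ε c hε h hc1
  set t := ((2 * r : ℕ) : ℝ) * ε with hts
  have ht0 : 0 ≤ t := by positivity
  have hb : 0 < 2 * r := by omega
  -- a sample size up to `2 * r` is refuted by both tails together
  have hlt : 2 * r < N := by
    by_contra hcon
    push Not at hcon
    have h1 := hN.card_abs_sum_coin_le hH hδ.le hcon hb
      ((Finset.univ.filter fun ω : Fin (2 * r) → Bool => ∑ i, coin (ω i) < -t) ∪
        upperTail coin (2 * r) t) (by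
        intro ω hω
        rw [Finset.mem_union, Finset.mem_filter, mem_upperTail] at hω
        rw [lt_abs]
        rcases hω with hω | hω
        · exact Or.inr (by linarith [hω.2])
        · exact Or.inl hω)
    rw [Finset.card_union_of_disjoint, card_lowerTail_coin] at h1
    · push_cast at h1
      have : δ * 2 ^ (2 * r) ≤ c * 2 ^ (2 * r) := by gcongr
      linarith
    · rw [Finset.disjoint_left]
      intro ω h2 h3
      rw [Finset.mem_filter] at h2
      rw [mem_upperTail] at h3
      linarith [h2.2]
  -- `l + 1` blocks make up a sample of size between `N` and `2 * N`
  set l := N / (2 * r) with hl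
  have hl1 : N ≤ (l + 1) * (2 * r) := by
    have := Nat.lt_mul_div_succ N hb
    rw [mul_comm]
    exact this.le
  have hl2 : (l + 1) * (2 * r) ≤ 2 * N := by
    have := Nat.div_mul_le_self N (2 * r)
    rw [← hl] at this
    linarith
  have h1 := hN.card_abs_sum_coin_le hH hδ.le hl1 (by positivity)
    (upperTail coin ((l + 1) * (2 * r)) ((l + 1 : ℕ) * t)) (by
      intro ω hω
      rw [mem_upperTail] at hω
      refine lt_of_eq_of_lt ?_ (hω.trans_le (le_abs_self _))
      rw [hts]
      push_cast
      ring)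
  have h2 : ((_ : ℕ) : ℝ) ≤ _ := Nat.cast_le.2 (pow_card_upperTail_le coin (2 * r) t l)
  push_cast at h2 h1
  have h3 : (c / 2) ^ (l + 1) ≤ δ := by
    have h4 : (c / 2 * 2 ^ (2 * r)) ^ (l + 1) ≤ δ * 2 ^ ((l + 1) * (2 * r)) := by
      refine le_trans ?_ (h2.trans h1)
      gcongr
      linarith
    rw [mul_pow, ← pow_mul, mul_comm (2 * r)] at h4
    exact le_of_mul_le_mul_right h4 (by positivity)
  have h5 := Real.log_le_log (by positivity) h3
  rw [Real.log_pow] at h5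
  have h6 : Real.log (c / 2) = -Real.log (2 / c) := by
    rw [← Real.log_inv, inv_div]
  rw [h6] at h5
  have h7 : 0 < Real.log (2 / c) := Real.log_pos (by rw [lt_div_iff₀ hc0]; linarith)
  have h8 : (((l + 1) * (2 * r) : ℕ) : ℝ) ≤ ((2 * N : ℕ) : ℝ) := Nat.cast_le.2 hl2
  push_cast at h8 h5
  rw [one_div, Real.log_inv]
  have hr' : (0 : ℝ) < r := by exact_mod_cast hr
  nlinarith [mul_le_mul_of_nonneg_right h8 h7.le]

/-- The lower bound of order `log (1 / δ) / ε ^ 2`, which holds for every class. -/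
theorem exists_mul_log_div_sq_le (c : ℝ) (hc0 : 0 < c) (hc1 : c < 1) :
    ∃ k : ℝ, 0 < k ∧ ∀ (X : Type*) (Y : Type*) [MeasurableSpace (X × Y)]
      [MeasurableSingletonClass (X × Y)] [Nonempty X] [Nontrivial Y] (H : Set (X → Y)),
      H.Nonempty → ∀ (ε δ : ℝ) (N : ℕ), 0 < ε → ε ≤ c → 0 < δ → δ ≤ c →
      IsUCSampleSize H ε δ N → k * (Real.log (1 / δ) / ε ^ 2) ≤ N := by
  set η := 1 - c with hη
  have hη0 : 0 < η := by linarith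
  obtain ⟨K, hK⟩ := exists_nat_gt (1 / η)
  have hK0 : (0 : ℝ) < K := lt_trans (by positivity) hK
  set A : ℝ := Real.log (K + 1) with hA
  have hA0 : 0 < A := Real.log_pos (by linarith)
  have hL0 : 0 < Real.log (2 / c) := Real.log_pos (by rw [lt_div_iff₀ hc0]; linarith)
  set x : ℝ := η ^ 2 / 32 with hx
  set e : ℝ := x / (4 / η ^ 2 + 1) with he
  have hx0 : 0 < x := by positivity
  have he0 : 0 < e := by positivity
  refine ⟨min (e / A) (x / (2 * Real.log (2 / c))), by positivity, ?_⟩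
  intro X Y _ _ _ _ H hH ε δ N hε hεc hδ hδc hN
  have hlog : 0 < Real.log (1 / δ) := Real.log_pos (by rw [lt_div_iff₀ hδ]; linarith)
  -- `e` is the threshold for `ε ^ 2` between the biased and the fair coin
  rcases le_total e (ε ^ 2) with hcase | hcase
  · have h1 := hN.one_le_mul_pow hH hδ.le K (by
      refine lt_of_le_of_lt hεc ?_
      rw [lt_div_iff₀ (by positivity)]
      rw [div_lt_iff₀ hη0] at hK
      rw [hη] at hK
      linarith)
    have h2 : Real.log (1 / δ) ≤ N * A := by
      rw [hA, ← Real.log_pow]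
      refine Real.log_le_log (by positivity) ?_
      rw [div_le_iff₀ hδ, mul_comm]
      exact h1
    calc min (e / A) (x / (2 * Real.log (2 / c))) * (Real.log (1 / δ) / ε ^ 2)
        ≤ e / A * (Real.log (1 / δ) / e) := by
          gcongr
          exact min_le_left _ _
      _ = Real.log (1 / δ) / A := by field_simp
      _ ≤ N := by rwa [div_le_iff₀ hA0]
  · -- `r ≈ η ^ 2 / (32 * ε ^ 2)` makes `4 * r * ε ≤ η / 2 * √(2 * r + 1)`, and `r > 4 / η ^ 2`
    -- makes the other half of `η * √(2 * r + 1)` exceed `1`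
    set r := ⌊x / ε ^ 2⌋₊ with hr
    have hr1 : 4 / η ^ 2 + 1 ≤ x / ε ^ 2 := by
      rw [le_div_iff₀ (by positivity)]
      rw [he, le_div_iff₀ (by positivity)] at hcase
      linarith
    have hr2 : (r : ℝ) ≤ x / ε ^ 2 := Nat.floor_le (by positivity)
    have hr3 : x / ε ^ 2 < r + 1 := Nat.lt_floor_add_one _
    have hr4 : 4 / η ^ 2 < r := by linarith
    have hr0 : (0 : ℝ) < r := lt_trans (by positivity) hr4
    have hsq : (√(2 * r + 1)) ^ 2 = 2 * r + 1 := Real.sq_sqrt (by positivity)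
    have h1 : 4 * r * ε + 1 < η * √(2 * r + 1) := by
      have h2 : 4 * r * ε ≤ η / 2 * √(2 * r + 1) := by
        refine abs_le_of_sq_le_sq' ?_ (by positivity) |>.2
        rw [mul_pow, mul_pow _ (√_), hsq]
        rw [hx, le_div_iff₀ (by positivity)] at hr2
        nlinarith [sq_nonneg η]
      have h3 : 1 < η / 2 * √(2 * r + 1) := by
        refine lt_of_pow_lt_pow_left₀ 2 (by positivity) ?_
        rw [mul_pow, hsq]
        rw [div_lt_iff₀ (by positivity)] at hr4
        nlinarith [sq_nonneg η]
      linarith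
    have h2 := hN.mul_log_le_of_coin hH hc0 hc1 hε.le hδ hδc r (by exact_mod_cast hr0) h1
    have h3 : x / ε ^ 2 ≤ 2 * r := by
      have : (1 : ℝ) ≤ r := by exact_mod_cast hr0
      linarith
    calc min (e / A) (x / (2 * Real.log (2 / c))) * (Real.log (1 / δ) / ε ^ 2)
        ≤ x / (2 * Real.log (2 / c)) * (Real.log (1 / δ) / ε ^ 2) := by
          gcongr
          exact min_le_right _ _
      _ = x / ε ^ 2 * Real.log (1 / δ) / (2 * Real.log (2 / c)) := by ring
      _ ≤ 2 * r * Real.log (1 / δ) / (2 * Real.log (2 / c)) := by gcongr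
      _ ≤ N := by rwa [div_le_iff₀ (by positivity)]

end

/-! ### The lower bound from a shattered set -/

theorem Shatters.exists_loss_eq {H : Set (X → Y)} {f : X → Y} {A : Finset X}
    (hA : Shatters (disagreement f '' H) A) {Ω : Type} (e : Ω ↪ A) (P : Set Ω) :
    ∃ h ∈ H, ∀ ω, zeroOneLoss h ((e ω : X), f (e ω)) = P.indicator 1 ω := by
  classical
  obtain ⟨g, ⟨h, hh, rfl⟩, hg⟩ := hA fun x => if ∃ ω ∈ P, (e ω : X) = x then 1 else 0
  refine ⟨h, hh, fun ω => ?_⟩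
  have h1 := hg (e ω) (e ω).2
  have h2 : (∃ ω' ∈ P, (e ω' : X) = e ω) ↔ ω ∈ P := by
    constructor
    · rintro ⟨ω', h3, h4⟩
      rwa [← e.injective (Subtype.ext h4)]
    · exact fun h3 => ⟨ω, h3, rfl⟩
  simp only [h2, disagreement] at h1
  by_cases h3 : ω ∈ P <;> by_cases h4 : h (e ω) = f (e ω) <;> simp_all [zeroOneLoss]

section

variable [MeasurableSpace (X × Y)] [MeasurableSingletonClass (X × Y)] {H : Set (X → Y)}

/-- Under the uniform distribution on a shattered set, the hypothesis that errs exactly off a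
sample of `N` points has empirical risk `0` and risk at least `1 - N / |A|`. -/
theorem IsUCSampleSize.one_sub_mul_card_le {ε δ : ℝ} {N : ℕ} (hN : IsUCSampleSize H ε δ N)
    (hδ : 0 ≤ δ) (hδ1 : δ < 1) {f : X → Y} {A : Finset X}
    (hA : Shatters (disagreement f '' H) A) : (1 - ε) * A.card ≤ N := by
  classical
  rcases Nat.eq_zero_or_pos A.card with h0 | h0
  · rw [h0]
    simp
  by_contra hcon
  push Not at hcon
  have : Nonempty (Fin A.card) := ⟨⟨0, h0⟩⟩
  have hd : (0 : ℝ) < A.card := by exact_mod_cast h0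
  obtain ⟨e⟩ : Nonempty (Fin A.card ↪ A) :=
    Function.Embedding.nonempty_of_card_le (by simp)
  have h1 := hN.card_le hδ le_rfl (Ω := Fin A.card) (fun i => ((e i : X), f (e i)))
    Finset.univ (by
      intro ω _
      obtain ⟨h, hh, hl⟩ := hA.exists_loss_eq e (Set.range ω)ᶜ
      refine ⟨h, hh, ?_⟩
      simp only [hl]
      have h2 : ∑ i, (Set.range ω)ᶜ.indicator (1 : Fin A.card → ℝ) (ω i) = 0 :=
        Finset.sum_eq_zero fun i _ => Set.indicator_of_notMem (by simp) _
      have h3 : (A.card : ℝ) - N ≤ ∑ x, (Set.range ω)ᶜ.indicator (1 : Fin A.card → ℝ) x := by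
        have h4 : ∀ x, (Set.range ω)ᶜ.indicator (1 : Fin A.card → ℝ) x =
            1 - if x ∈ Finset.univ.image ω then 1 else 0 := by
          intro x
          by_cases hx : x ∈ Set.range ω
          · have hx' : x ∈ Finset.univ.image ω := by simpa using hx
            rw [if_pos hx', Set.indicator_of_notMem (by simpa using hx)]
            simp
          · have hx' : x ∉ Finset.univ.image ω := by simpa using hx
            rw [if_neg hx', Set.indicator_of_mem (by simpa using hx)]
            simp
        simp_rw [h4]
        rw [Finset.sum_sub_distrib, Finset.sum_boole, Finset.filter_mem_eq_inter,
          Finset.univ_inter]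
        have h5 : ((Finset.univ.image ω).card : ℝ) ≤ N := by
          exact_mod_cast Finset.card_image_le.trans (by simp)
        simp only [Finset.sum_const, Finset.card_univ, Fintype.card_fin, nsmul_eq_mul, mul_one]
        linarith
      rw [h2, mul_zero, sub_zero, Fintype.card_fin]
      refine lt_of_lt_of_le ?_ (le_abs_self _)
      rw [lt_div_iff₀ hd]
      linarith)
  simp only [Finset.card_univ, Fintype.card_fun, Fintype.card_fin] at h1
  push_cast at h1
  have : (0 : ℝ) < (A.card : ℝ) ^ N := by positivity
  nlinarith

end

/-! ### Signed counts of a uniform sample of pairs -/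

/-- Summation over the last `m` coordinates and then over the first, which sets up the inductions on
the sample size for the moments below. -/
theorem sum_fin_succ_fun {Ω : Type} [Fintype Ω] {m : ℕ} (F : (Fin (m + 1) → Ω) → ℝ) :
    ∑ ω, F ω = ∑ ω : Fin m → Ω, ∑ x, F (Fin.cons x ω) := by
  rw [Finset.sum_comm, ← (Fin.consEquiv fun _ => Ω).sum_comp F, Fintype.sum_prod_type]
  rfl

/-- The contribution `± 1` or `0` of an example `p` to the signed count of `j`. -/
def signAt {k : ℕ} (j : Fin k) (p : Fin k × Bool) : ℝ :=
  if p.1 = j then (if p.2 then 1 else -1) else 0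

/-- The number of occurrences of `(j, true)` minus that of `(j, false)`. -/
def signedCount {k m : ℕ} (j : Fin k) (ω : Fin m → Fin k × Bool) : ℝ :=
  ∑ i, signAt j (ω i)

theorem signedCount_cons {k m : ℕ} (j : Fin k) (p : Fin k × Bool) (ω : Fin m → Fin k × Bool) :
    signedCount j (Fin.cons p ω : Fin (m + 1) → Fin k × Bool) = signAt j p + signedCount j ω := by
  simp [signedCount, Fin.sum_univ_succ]

theorem sum_signAt_add_sq {k : ℕ} (j : Fin k) (r : ℝ) :
    ∑ p, (signAt j p + r) ^ 2 = 2 * k * r ^ 2 + 2 := by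
  have h : ∀ i : Fin k, (signAt j (i, true) + r) ^ 2 + (signAt j (i, false) + r) ^ 2 =
      2 * r ^ 2 + if i = j then 2 else 0 := by
    intro i
    by_cases hi : i = j <;> simp [signAt, hi] <;> ring
  rw [Fintype.sum_prod_type]
  simp_rw [Fintype.sum_bool, h]
  rw [Finset.sum_add_distrib, Finset.sum_ite_eq' Finset.univ j]
  simp
  ring

theorem sum_signAt_add_pow_four {k : ℕ} (j : Fin k) (r : ℝ) :
    ∑ p, (signAt j p + r) ^ 4 = 2 * k * r ^ 4 + 12 * r ^ 2 + 2 := by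
  have h : ∀ i : Fin k, (signAt j (i, true) + r) ^ 4 + (signAt j (i, false) + r) ^ 4 =
      2 * r ^ 4 + if i = j then 12 * r ^ 2 + 2 else 0 := by
    intro i
    by_cases hi : i = j <;> simp [signAt, hi] <;> ring
  rw [Fintype.sum_prod_type]
  simp_rw [Fintype.sum_bool, h]
  rw [Finset.sum_add_distrib, Finset.sum_ite_eq' Finset.univ j]
  simp
  ring

theorem sum_signedCount_sq {k : ℕ} (hk : 0 < k) (m : ℕ) (j : Fin k) :
    ∑ ω : Fin m → Fin k × Bool, signedCount j ω ^ 2 = (2 * k : ℝ) ^ m * (m / k) := by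
  have hk' : (0 : ℝ) < k := by exact_mod_cast hk
  induction m with
  | zero => simp [signedCount]
  | succ m ih =>
    rw [sum_fin_succ_fun]
    simp_rw [signedCount_cons, sum_signAt_add_sq]
    rw [Finset.sum_add_distrib, ← Finset.mul_sum, ih]
    simp [mul_comm]
    field_simp
    ring

theorem sum_signedCount_pow_four {k : ℕ} (hk : 0 < k) (m : ℕ) (j : Fin k) :
    ∑ ω : Fin m → Fin k × Bool, signedCount j ω ^ 4 =
      (2 * k : ℝ) ^ m * (m / k + 3 * m * (m - 1) / k ^ 2) := by
  have hk' : (0 : ℝ) < k := by exact_mod_cast hk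
  induction m with
  | zero => simp [signedCount]
  | succ m ih =>
    rw [sum_fin_succ_fun]
    simp_rw [signedCount_cons, sum_signAt_add_pow_four]
    rw [Finset.sum_add_distrib, Finset.sum_add_distrib, ← Finset.mul_sum, ← Finset.mul_sum, ih,
      sum_signedCount_sq hk]
    simp [mul_comm]
    field_simp
    ring

theorem sum_signedCount_cons_sq {k m : ℕ} (p : Fin k × Bool) (ω : Fin m → Fin k × Bool) :
    ∑ j, signedCount j (Fin.cons p ω : Fin (m + 1) → Fin k × Bool) ^ 2 =
      ∑ j, signedCount j ω ^ 2 + 2 * (if p.2 then 1 else -1) * signedCount p.1 ω + 1 := by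
  have h : ∀ j, signedCount j (Fin.cons p ω : Fin (m + 1) → Fin k × Bool) ^ 2 =
      signedCount j ω ^ 2 +
        if p.1 = j then 2 * (if p.2 then 1 else -1) * signedCount p.1 ω + 1 else 0 := by
    intro j
    rw [signedCount_cons]
    obtain ⟨i, s⟩ := p
    by_cases hj : i = j
    · subst hj
      cases s <;> simp [signAt] <;> ring
    · simp [signAt, hj]
  simp_rw [h]
  rw [Finset.sum_add_distrib, Finset.sum_ite_eq Finset.univ p.1]
  simp [add_assoc]

/-- The variance of the sum of the squared signed counts. -/
theorem sum_sub_sq_signedCount {k : ℕ} (hk : 0 < k) (m : ℕ) :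
    ∑ ω : Fin m → Fin k × Bool, (∑ j, signedCount j ω ^ 2 - m) ^ 2 =
      (2 * k : ℝ) ^ m * (2 * m * (m - 1) / k) := by
  have hk' : (0 : ℝ) < k := by exact_mod_cast hk
  induction m with
  | zero => simp [signedCount]
  | succ m ih =>
    rw [sum_fin_succ_fun]
    have h : ∀ ω : Fin m → Fin k × Bool,
        ∑ p, (∑ j, signedCount j (Fin.cons p ω : Fin (m + 1) → Fin k × Bool) ^ 2 -
          ((m + 1 : ℕ) : ℝ)) ^ 2 =
        2 * k * (∑ j, signedCount j ω ^ 2 - m) ^ 2 + 8 * ∑ j, signedCount j ω ^ 2 := by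
      intro ω
      simp_rw [sum_signedCount_cons_sq]
      set Q := ∑ j, signedCount j ω ^ 2 with hQ
      rw [Fintype.sum_prod_type]
      have h1 : ∀ i : Fin k, ∑ s : Bool,
          (Q + 2 * (if s then 1 else -1) * signedCount i ω + 1 - ((m + 1 : ℕ) : ℝ)) ^ 2 =
            2 * (Q - m) ^ 2 + 8 * signedCount i ω ^ 2 := by
        intro i
        rw [Fintype.sum_bool]
        simp
        ring
      refine (Finset.sum_congr rfl fun i _ => h1 i).trans ?_
      rw [Finset.sum_add_distrib, ← Finset.mul_sum, ← Finset.mul_sum, ← hQ]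
      simp
      ring
    simp_rw [h]
    rw [Finset.sum_add_distrib, ← Finset.mul_sum, ← Finset.mul_sum, ih, Finset.sum_comm]
    simp_rw [sum_signedCount_sq hk]
    simp
    field_simp
    ring

/-- Markov's inequality for the counting measure. -/
theorem card_filter_mul_le_sum {ι : Type*} [Fintype ι] (F : ι → ℝ) (hF : ∀ i, 0 ≤ F i) (t : ℝ)
    (p : ι → Prop) [DecidablePred p] (hp : ∀ i, p i → t ≤ F i) :
    ((Finset.univ.filter p).card : ℝ) * t ≤ ∑ i, F i := by
  calc ((Finset.univ.filter p).card : ℝ) * t = ∑ _i ∈ Finset.univ.filter p, t := by simp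
    _ ≤ ∑ i ∈ Finset.univ.filter p, F i :=
      Finset.sum_le_sum fun i hi => hp i (Finset.mem_filter.1 hi).2
    _ ≤ _ := Finset.sum_le_sum_of_subset_of_nonneg (Finset.filter_subset _ _) fun i _ _ => hF i

/-- `|r| ≥ r ^ 2 / s - r ^ 4 / s ^ 3` converts second and fourth moments into a lower bound for the
first absolute moment. -/
theorem sq_div_sub_pow_div_le_abs (r s : ℝ) (hs : 0 < s) : r ^ 2 / s - r ^ 4 / s ^ 3 ≤ |r| := by
  obtain ⟨u, hu⟩ : ∃ u, u = |r| / s := ⟨_, rfl⟩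
  have hu0 : 0 ≤ u := by rw [hu]; positivity
  have hr : |r| = u * s := by rw [hu]; field_simp
  have h2 : r ^ 2 = (u * s) ^ 2 := by rw [← hr, sq_abs]
  have h4 : r ^ 4 = (u * s) ^ 4 := by
    rw [← hr, ← abs_pow, abs_of_nonneg (by positivity)]
  rw [h2, h4, hr]
  have : (u * s) ^ 2 / s - (u * s) ^ 4 / s ^ 3 = (u ^ 2 - u ^ 4) * s := by
    field_simp
  rw [this]
  refine mul_le_mul_of_nonneg_right ?_ hs.le
  rcases le_total u 1 with h | h
  · nlinarith [pow_nonneg hu0 4]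
  · nlinarith [mul_self_nonneg (u ^ 2), mul_nonneg hu0 hu0]

/-- Typical second and fourth moments force a large first absolute moment. -/
theorem lt_sum_abs_signedCount {k m : ℕ} (hk : 0 < k) (hm : 0 < m) {a ε : ℝ} (ha : 0 < a)
    (h : 1024 * a * ε ^ 2 * m ≤ k) (ω : Fin m → Fin k × Bool)
    (h2 : (m : ℝ) / 2 < ∑ j, signedCount j ω ^ 2)
    (h4 : ∑ j, signedCount j ω ^ 4 ≤ 4 * a * m ^ 2 / k) :
    2 * m * ε < ∑ j, |signedCount j ω| := by
  have hk' : (0 : ℝ) < k := by exact_mod_cast hk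
  have hm' : (0 : ℝ) < m := by exact_mod_cast hm
  -- for this scale `s` the fourth moments cancel at most half of `(∑ R ^ 2) / s`
  set s := √(16 * a * m / k) with hs
  have hs0 : 0 < s := Real.sqrt_pos.2 (by positivity)
  have hs2 : s ^ 2 = 16 * a * m / k := Real.sq_sqrt (by positivity)
  have h5 : ∑ j, (signedCount j ω ^ 2 / s - signedCount j ω ^ 4 / s ^ 3) ≤
      ∑ j, |signedCount j ω| :=
    Finset.sum_le_sum fun j _ => sq_div_sub_pow_div_le_abs _ _ hs0
  rw [Finset.sum_sub_distrib, ← Finset.sum_div, ← Finset.sum_div] at h5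
  have h6 : (m : ℝ) / 2 / s < (∑ j, signedCount j ω ^ 2) / s := by gcongr
  have h7 : (∑ j, signedCount j ω ^ 4) / s ^ 3 ≤ m / 4 / s := by
    calc (∑ j, signedCount j ω ^ 4) / s ^ 3 ≤ 4 * a * m ^ 2 / k / s ^ 3 := by gcongr
      _ = 4 * a * m ^ 2 / k / s ^ 2 / s := by field_simp
      _ = m / 4 / s := by
        rw [hs2]
        field_simp
        norm_num
  have h8 : s * (8 * ε) ≤ 1 := by
    refine abs_le_of_sq_le_sq' ?_ (by norm_num) |>.2
    rw [mul_pow, hs2, div_mul_eq_mul_div, one_pow, div_le_one hk']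
    linarith
  have h9 : 2 * m * ε ≤ m / 4 / s := by
    rw [le_div_iff₀ hs0]
    nlinarith
  have h10 : (m : ℝ) / 2 / s = m / 4 / s + m / 4 / s := by ring
  linarith

/-- The mean absolute signed count exceeds `2 * ε` except with probability `8 / k` for the second
moments and `1 / a` for the fourth. -/
theorem le_card_sum_abs_signedCount {k m : ℕ} (hk : 0 < k) (hkm : k ≤ m) {a ε : ℝ} (ha : 0 < a)
    (h : 1024 * a * ε ^ 2 * m ≤ k) :
    (1 - 8 / k - 1 / a) * (2 * k : ℝ) ^ m ≤
      ((Finset.univ.filter fun ω : Fin m → Fin k × Bool =>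
        2 * m * ε < ∑ j, |signedCount j ω|).card : ℝ) := by
  classical
  have hm : 0 < m := hk.trans_le hkm
  have hk' : (0 : ℝ) < k := by exact_mod_cast hk
  have hm' : (0 : ℝ) < m := by exact_mod_cast hm
  have hkm' : (k : ℝ) ≤ m := by exact_mod_cast hkm
  set n : ℝ := (2 * k : ℝ) ^ m with hn
  have hn0 : 0 < n := by positivity
  set G := Finset.univ.filter fun ω : Fin m → Fin k × Bool => 2 * m * ε < ∑ j, |signedCount j ω|
  set B₂ := Finset.univ.filter fun ω : Fin m → Fin k × Bool =>
    ∑ j, signedCount j ω ^ 2 ≤ (m : ℝ) / 2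
  set B₄ := Finset.univ.filter fun ω : Fin m → Fin k × Bool =>
    4 * a * m ^ 2 / k ≤ ∑ j, signedCount j ω ^ 4
  have hB₂ : (B₂.card : ℝ) ≤ 8 / k * n := by
    have h1 := card_filter_mul_le_sum
      (fun ω : Fin m → Fin k × Bool => (∑ j, signedCount j ω ^ 2 - m) ^ 2)
      (fun _ => sq_nonneg _) ((m : ℝ) ^ 2 / 4)
      (fun ω => ∑ j, signedCount j ω ^ 2 ≤ (m : ℝ) / 2) (fun ω hω => by nlinarith)
    rw [sum_sub_sq_signedCount hk] at h1
    have h2 : (2 * k : ℝ) ^ m * (2 * m * (m - 1) / k) ≤ 8 / k * n * ((m : ℝ) ^ 2 / 4) := by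
      have : (2 * m * (m - 1) / k : ℝ) ≤ 2 * m * m / k := by gcongr; linarith
      calc (2 * k : ℝ) ^ m * (2 * m * (m - 1) / k) ≤ n * (2 * m * m / k) := by
            rw [hn]; gcongr
        _ = _ := by ring
    exact le_of_mul_le_mul_right (h1.trans h2) (by positivity)
  have hB₄ : (B₄.card : ℝ) ≤ 1 / a * n := by
    have h1 := card_filter_mul_le_sum
      (fun ω : Fin m → Fin k × Bool => ∑ j, signedCount j ω ^ 4)
      (fun ω => Finset.sum_nonneg fun j _ => by positivity) (4 * a * m ^ 2 / k)
      (fun ω => 4 * a * m ^ 2 / k ≤ ∑ j, signedCount j ω ^ 4) (fun ω hω => hω)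
    rw [Finset.sum_comm] at h1
    simp_rw [sum_signedCount_pow_four hk] at h1
    have h2 : ∑ _j : Fin k, (2 * k : ℝ) ^ m * (m / k + 3 * m * (m - 1) / k ^ 2) ≤
        1 / a * n * (4 * a * m ^ 2 / k) := by
      simp only [Finset.sum_const, Finset.card_univ, Fintype.card_fin, nsmul_eq_mul]
      have h3 : (k : ℝ) * (m / k + 3 * m * (m - 1) / k ^ 2) ≤ 4 * m ^ 2 / k := by
        have : (k : ℝ) * (m / k + 3 * m * (m - 1) / k ^ 2) = (m * k + 3 * m * (m - 1)) / k := by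
          field_simp
        rw [this]
        gcongr
        nlinarith
      calc (k : ℝ) * ((2 * k : ℝ) ^ m * (m / k + 3 * m * (m - 1) / k ^ 2))
          = n * ((k : ℝ) * (m / k + 3 * m * (m - 1) / k ^ 2)) := by rw [hn]; ring
        _ ≤ n * (4 * m ^ 2 / k) := by gcongr
        _ = _ := by field_simp
    exact le_of_mul_le_mul_right (h1.trans h2) (by positivity)
  have hcover : (Finset.univ : Finset (Fin m → Fin k × Bool)) ⊆ G ∪ (B₂ ∪ B₄) := by
    intro ω _
    simp only [Finset.mem_union, Finset.mem_filter, Finset.mem_univ, true_and, G, B₂, B₄]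
    by_contra hcon
    push Not at hcon
    exact absurd (lt_sum_abs_signedCount hk hm ha h ω hcon.2.1 hcon.2.2.le)
      (not_lt.2 hcon.1)
  have h5 := (Finset.card_le_card hcover).trans ((Finset.card_union_le _ _).trans
    (Nat.add_le_add_left (Finset.card_union_le _ _) _))
  have h6 : (((k * 2) ^ m : ℕ) : ℝ) ≤ _ := Nat.cast_le.2 (by simpa using h5)
  push_cast at h6
  rw [mul_comm (k : ℝ) 2, ← hn] at h6
  linarith

section

variable [MeasurableSpace (X × Y)] [MeasurableSingletonClass (X × Y)] {H : Set (X → Y)}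

/-- Under the uniform distribution on `k` pairs of points of a shattered set, the hypothesis that
errs on the more frequent point of each pair deviates by half the mean absolute signed count. -/
theorem IsUCSampleSize.one_sub_le_of_pairs {ε δ : ℝ} {N m k : ℕ} (hN : IsUCSampleSize H ε δ N)
    (hδ : 0 ≤ δ) (hNm : N ≤ m) {f : X → Y} {A : Finset X}
    (hA : Shatters (disagreement f '' H) A) (hk : 0 < k) (hkA : 2 * k ≤ A.card) (hkm : k ≤ m)
    {a : ℝ} (ha : 0 < a) (h : 1024 * a * ε ^ 2 * m ≤ k) : 1 - 8 / k - 1 / a ≤ δ := by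
  classical
  have hm : 0 < m := hk.trans_le hkm
  have hm' : (0 : ℝ) < m := by exact_mod_cast hm
  have hk' : (0 : ℝ) < k := by exact_mod_cast hk
  have : Nonempty (Fin k × Bool) := ⟨(⟨0, hk⟩, true)⟩
  obtain ⟨e⟩ : Nonempty (Fin k × Bool ↪ A) :=
    Function.Embedding.nonempty_of_card_le (by simpa [mul_comm] using hkA)
  have h1 := hN.card_le hδ hNm (Ω := Fin k × Bool) (fun p => ((e p : X), f (e p)))
    (Finset.univ.filter fun ω : Fin m → Fin k × Bool => 2 * m * ε < ∑ j, |signedCount j ω|) (by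
      intro ω hω
      have hω := (Finset.mem_filter.1 hω).2
      obtain ⟨h, hh, hl⟩ := hA.exists_loss_eq e
        {p | p.2 = true ↔ 0 ≤ signedCount p.1 ω}
      refine ⟨h, hh, ?_⟩
      simp only [hl]
      -- the loss at `(j, s)` is `(1 + τ j * s) / 2`, where `τ j` is the sign of the count of `j`
      set τ : Fin k → ℝ := fun j => if 0 ≤ signedCount j ω then 1 else -1 with hτ
      have h2 : ∀ p : Fin k × Bool,
          Set.indicator {p : Fin k × Bool | p.2 = true ↔ 0 ≤ signedCount p.1 ω}
            (1 : Fin k × Bool → ℝ) p =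
            1 / 2 + 1 / 2 * ∑ j, τ j * signAt j p := by
        rintro ⟨i, s⟩
        have h3 : ∑ j, τ j * signAt j (i, s) = τ i * if s then 1 else -1 := by
          simp only [signAt, mul_ite, mul_zero]
          rw [Finset.sum_ite_eq Finset.univ i]
          simp
        rw [h3]
        by_cases h0 : 0 ≤ signedCount i ω <;> cases s <;> simp [Set.indicator, hτ, h0] <;>
          norm_num
      have h4 : (∑ p : Fin k × Bool, (1 / 2 + 1 / 2 * ∑ j, τ j * signAt j p)) = k := by
        rw [Fintype.sum_prod_type]
        simp only [Fintype.sum_bool]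
        have h5 : ∀ i : Fin k, (1 / 2 + 1 / 2 * ∑ j, τ j * signAt j (i, true)) +
            (1 / 2 + 1 / 2 * ∑ j, τ j * signAt j (i, false)) = (1 : ℝ) := by
          intro i
          have h6 : ∑ j, τ j * signAt j (i, false) = -∑ j, τ j * signAt j (i, true) := by
            rw [← Finset.sum_neg_distrib]
            refine Finset.sum_congr rfl fun j _ => ?_
            by_cases hij : i = j <;> simp [signAt, hij]
          rw [h6]
          ring
        simp_rw [h5]
        simp
      have h7 : (∑ i, (1 / 2 + 1 / 2 * ∑ j, τ j * signAt j (ω i))) =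
          m / 2 + 1 / 2 * ∑ j, |signedCount j ω| := by
        rw [Finset.sum_add_distrib, ← Finset.mul_sum, Finset.sum_comm]
        have h8 : ∀ j, ∑ i, τ j * signAt j (ω i) = |signedCount j ω| := by
          intro j
          rw [← Finset.mul_sum]
          change τ j * signedCount j ω = _
          by_cases h0 : 0 ≤ signedCount j ω
          · simp [hτ, h0, abs_of_nonneg h0]
          · simp [hτ, h0, abs_of_neg (not_le.1 h0)]
        simp_rw [h8]
        simp
        ring
      simp_rw [h2]
      rw [h4, h7]
      have h9 : (k : ℝ) / (Fintype.card (Fin k × Bool) : ℝ) -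
          1 / (m : ℝ) * (m / 2 + 1 / 2 * ∑ j, |signedCount j ω|) =
          -((∑ j, |signedCount j ω|) / (2 * m)) := by
        simp
        field_simp
        ring
      rw [h9, abs_neg]
      refine lt_of_lt_of_le ?_ (le_abs_self _)
      rw [lt_div_iff₀ (by positivity)]
      linarith)
  have h2 := (le_card_sum_abs_signedCount hk hkm ha h).trans h1
  simp only [Fintype.card_prod, Fintype.card_fin, Fintype.card_bool] at h2
  push_cast at h2
  rw [mul_comm (k : ℝ) 2] at h2
  exact le_of_mul_le_mul_right h2 (by positivity)

end

/-- The lower bound of order `|A| / ε ^ 2` for a shattered set `A`. -/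
theorem exists_mul_card_div_sq_le (c : ℝ) (hc0 : 0 < c) (hc1 : c < 1) :
    ∃ k : ℝ, 0 < k ∧ ∀ (X : Type*) (Y : Type*) [MeasurableSpace (X × Y)]
      [MeasurableSingletonClass (X × Y)] [Nonempty X] [Nontrivial Y] (H : Set (X → Y)),
      H.Nonempty → ∀ (ε δ : ℝ) (N : ℕ), 0 < ε → ε ≤ c → 0 < δ → δ ≤ c →
      IsUCSampleSize H ε δ N → ∀ (f : X → Y) (A : Finset X),
      Shatters (disagreement f '' H) A → k * (A.card / ε ^ 2) ≤ N := by
  obtain ⟨k₀, hk₀, hcoin⟩ := exists_mul_log_div_sq_le c hc0 hc1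
  set η := 1 - c with hη
  have hη0 : 0 < η := by linarith
  have hη1 : η < 1 := by linarith
  set a : ℝ := 2 / η with ha
  have ha0 : 0 < a := by positivity
  set D : ℝ := 3 * (16 / η + 1) with hD
  have hD0 : 0 < D := by positivity
  set e : ℝ := 1 / (2048 * a) with he
  have he0 : 0 < e := by positivity
  set l := Real.log (1 / c) with hl
  have hl0 : 0 < l := Real.log_pos (by rw [lt_div_iff₀ hc0]; linarith)
  refine ⟨min (k₀ * l / D) (min (η * e) (1 / (3072 * a))), by positivity, ?_⟩
  intro X Y _ _ _ _ H hH ε δ N hε hεc hδ hδc hN f A hA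
  set d : ℝ := ((A.card : ℕ) : ℝ) with hd
  have hd0 : 0 ≤ d := by positivity
  -- up to the size `D` the `k ≈ d / 2` pairs are too few for `8 / k < η / 2`, and the coin takes
  -- over
  rcases le_total d D with hdD | hdD
  · have h1 := hcoin X Y H hH ε δ N hε hεc hδ hδc hN
    have h2 : l ≤ Real.log (1 / δ) := Real.log_le_log (by positivity) (by gcongr)
    calc _ ≤ k₀ * l / D * (D / ε ^ 2) := by
          gcongr
          exact min_le_left _ _
      _ = k₀ * (l / ε ^ 2) := by field_simp
      _ ≤ k₀ * (Real.log (1 / δ) / ε ^ 2) := by gcongr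
      _ ≤ N := h1
  rcases le_total e (ε ^ 2) with hcase | hcase
  · have h1 := hN.one_sub_mul_card_le hδ.le (lt_of_le_of_lt hδc hc1) hA
    calc _ ≤ η * e * (d / e) := by
          gcongr
          exact (min_le_right _ _).trans (min_le_left _ _)
      _ = η * d := by field_simp
      _ ≤ (1 - ε) * d := by gcongr; linarith
      _ ≤ N := h1
  · set k := A.card / 2 with hk
    have hk1 : d ≤ 2 * k + 1 := by
      have : A.card ≤ 2 * k + 1 := by omega
      rw [hd]
      exact_mod_cast this
    have hη16 : 16 < 16 / η := by rw [lt_div_iff₀ hη0]; linarith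
    have hk2 : 16 / η < k := by linarith
    have hk0 : (0 : ℝ) < k := by linarith
    set x : ℝ := k / (1024 * a * ε ^ 2) with hx
    have hx0 : 0 < x := by positivity
    have hkx : (k : ℝ) ≤ x := by
      rw [hx, le_div_iff₀ (by positivity)]
      rw [he, le_div_iff₀ (by positivity)] at hcase
      nlinarith
    have hxN : x ≤ N := by
      by_contra hcon
      push Not at hcon
      have h1 := hN.one_sub_le_of_pairs hδ.le (Nat.le_floor hcon.le) hA (k := k)
        (by exact_mod_cast hk0) (by omega) (Nat.le_floor hkx) ha0 (by
          have := Nat.floor_le hx0.le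
          calc (1024 * a * ε ^ 2 : ℝ) * (⌊x⌋₊ : ℝ) ≤ 1024 * a * ε ^ 2 * x := by gcongr
            _ = (k : ℝ) := by rw [hx]; field_simp)
      have h2 : 8 / (k : ℝ) < η / 2 := by
        rw [div_lt_iff₀ hk0]
        rw [div_lt_iff₀ hη0] at hk2
        linarith
      have h3 : 1 / a = η / 2 := by rw [ha]; field_simp
      linarith
    calc _ ≤ 1 / (3072 * a) * (3 * k / ε ^ 2) := by
          gcongr
          · exact (min_le_right _ _).trans (min_le_right _ _)
          · linarith
      _ = x := by rw [hx]; field_simp; norm_num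
      _ ≤ N := hxN

/-! ### Error patterns and random swaps -/

/-- The sign of a boolean, `-1` for `true`: the effect of an exchange on a difference of losses. -/
def boolSign (b : Bool) : ℝ := if b then -1 else 1

/-- Exponential moments of a Rademacher sum. -/
theorem sum_exp_rademacher_le {m : ℕ} (a : Fin m → ℝ) (ha : ∀ i, |a i| ≤ 1) (l : ℝ) :
    ∑ σ : Fin m → Bool, Real.exp (l * ∑ i, boolSign (σ i) * a i) ≤
      2 ^ m * Real.exp (m * l ^ 2 / 2) := by
  have h1 : ∀ σ : Fin m → Bool, Real.exp (l * ∑ i, boolSign (σ i) * a i) =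
      ∏ i, Real.exp (l * (boolSign (σ i) * a i)) := by
    intro σ
    rw [Finset.mul_sum, Real.exp_sum]
  simp_rw [h1]
  have h2 := Finset.prod_univ_sum (fun _ : Fin m => (Finset.univ : Finset Bool))
    (fun i b => Real.exp (l * (boolSign b * a i)))
  rw [Fintype.piFinset_univ] at h2
  rw [← h2]
  have h3 : ∀ i, ∑ b : Bool, Real.exp (l * (boolSign b * a i)) ≤ 2 * Real.exp (l ^ 2 / 2) := by
    intro i
    have h4 : ∑ b : Bool, Real.exp (l * (boolSign b * a i)) = 2 * Real.cosh (l * a i) := by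
      rw [Real.cosh_eq]
      simp [boolSign]
      ring
    rw [h4]
    have h5 := Real.cosh_le_exp_half_sq (l * a i)
    have h6 : (l * a i) ^ 2 ≤ l ^ 2 := by
      rw [mul_pow]
      have := (sq_le_one_iff_abs_le_one (a i)).2 (ha i)
      nlinarith [sq_nonneg l]
    have h7 : Real.exp ((l * a i) ^ 2 / 2) ≤ Real.exp (l ^ 2 / 2) :=
      Real.exp_le_exp.2 (by linarith)
    linarith
  calc ∏ i, ∑ b : Bool, Real.exp (l * (boolSign b * a i))
      ≤ ∏ _i : Fin m, 2 * Real.exp (l ^ 2 / 2) :=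
        Finset.prod_le_prod (fun i _ => Finset.sum_nonneg fun b _ => (Real.exp_pos _).le)
          fun i _ => h3 i
    _ = _ := by
      rw [Finset.prod_const, mul_pow, ← Real.exp_nat_mul]
      simp
      ring

theorem card_lt_rademacher_le {m : ℕ} (a : Fin m → ℝ) (ha : ∀ i, |a i| ≤ 1)
    {t : ℝ} (ht : 0 ≤ t) :
    ((Finset.univ.filter fun σ : Fin m → Bool => m * t < ∑ i, boolSign (σ i) * a i).card : ℝ) ≤
      2 ^ m * Real.exp (-(m * t ^ 2 / 2)) := by
  have h1 := card_filter_mul_le_sum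
    (fun σ : Fin m → Bool => Real.exp (t * ∑ i, boolSign (σ i) * a i))
    (fun _ => (Real.exp_pos _).le) (Real.exp (m * t ^ 2))
    (fun σ => m * t < ∑ i, boolSign (σ i) * a i) (fun σ hσ => by
      refine Real.exp_le_exp.2 ?_
      nlinarith)
  have h2 := h1.trans (sum_exp_rademacher_le a ha t)
  rw [← le_div_iff₀ (Real.exp_pos _), mul_div_assoc, ← Real.exp_sub] at h2
  refine h2.trans_eq ?_
  congr 2
  ring

/-- Hoeffding's inequality for Rademacher sums, as a count of signs. -/
theorem card_lt_abs_rademacher_le {m : ℕ} (a : Fin m → ℝ) (ha : ∀ i, |a i| ≤ 1)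
    {t : ℝ} (ht : 0 ≤ t) :
    ((Finset.univ.filter fun σ : Fin m → Bool => m * t < |∑ i, boolSign (σ i) * a i|).card : ℝ) ≤
      2 * (2 ^ m * Real.exp (-(m * t ^ 2 / 2))) := by
  classical
  have h1 := card_lt_rademacher_le a ha ht
  have h2 := card_lt_rademacher_le (fun i => -a i) (by simpa using ha) ht
  have h3 : (Finset.univ.filter fun σ : Fin m → Bool => m * t < |∑ i, boolSign (σ i) * a i|) ⊆
      (Finset.univ.filter fun σ : Fin m → Bool => m * t < ∑ i, boolSign (σ i) * a i) ∪
      (Finset.univ.filter fun σ : Fin m → Bool => m * t < ∑ i, boolSign (σ i) * -a i) := by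
    intro σ hσ
    simp only [Finset.mem_union, Finset.mem_filter, Finset.mem_univ, true_and, mul_neg,
      Finset.sum_neg_distrib] at hσ ⊢
    exact lt_abs.1 hσ
  have h4 : ((_ : ℕ) : ℝ) ≤ _ :=
    Nat.cast_le.2 ((Finset.card_le_card h3).trans (Finset.card_union_le _ _))
  push_cast at h4
  linarith

theorem card_le_graphDim {H : Set (X → Y)} {f : X → Y} {A : Finset X}
    (hA : Shatters (disagreement f '' H) A) : (A.card : ℕ∞) ≤ graphDim H :=
  (le_iSup₂ (f := fun (A : Finset X) (_ : Shatters (disagreement f '' H) A) => (A.card : ℕ∞))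
    A hA).trans (le_iSup (fun f => vcDim (disagreement f '' H)) f)

/-- The sets of indices at which the hypotheses of `H` err on the points `z i`. -/
def errorPatterns {ι : Type*} [Fintype ι] (H : Set (X → Y)) (z : ι → X × Y) :
    Finset (Finset ι) :=
  open Classical in
  Finset.univ.filter fun T => ∃ h ∈ H, ∀ i, i ∈ T ↔ h (z i).1 ≠ (z i).2

theorem mem_errorPatterns {ι : Type*} [Fintype ι] {H : Set (X → Y)} {z : ι → X × Y}
    {T : Finset ι} : T ∈ errorPatterns H z ↔ ∃ h ∈ H, ∀ i, i ∈ T ↔ h (z i).1 ≠ (z i).2 := by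
  simp [errorPatterns]

/-- Points shattered by the losses have distinct instances, and so are shattered by `H_f` for any
`f` that interpolates their labels. -/
theorem card_le_of_shatters_errorPatterns {ι : Type*} [Fintype ι] [DecidableEq ι] [Nonempty Y]
    {H : Set (X → Y)} {z : ι → X × Y} {T : Finset ι} (hT : (errorPatterns H z).Shatters T) :
    (T.card : ℕ∞) ≤ graphDim H := by
  classical
  have hpat : ∀ t ⊆ T, ∃ h ∈ H, ∀ i ∈ T, h (z i).1 ≠ (z i).2 ↔ i ∈ t := by
    intro t ht
    obtain ⟨u, hu, hut⟩ := hT ht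
    obtain ⟨h, hh, hi⟩ := mem_errorPatterns.1 hu
    refine ⟨h, hh, fun i hiT => ?_⟩
    rw [← hi, ← hut, Finset.mem_inter]
    tauto
  have hlab : ∀ i ∈ T, ∀ j ∈ T, (z i).1 = (z j).1 → (z i).2 = (z j).2 := by
    intro i hi j hj hij
    obtain ⟨h, -, hh⟩ := hpat ∅ (by simp)
    have h1 := hh i hi
    have h2 := hh j hj
    simp only [Finset.notMem_empty, iff_false, ne_eq, not_not] at h1 h2
    rw [← h1, ← h2, hij]
  have hinj : Set.InjOn (fun i => (z i).1) (T : Set ι) := by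
    intro i hi j hj hij
    by_contra hne
    obtain ⟨h, -, hh⟩ := hpat {i} (by simpa using hi)
    have h1 := (hh i hi).2 (by simp)
    have h2 := (hh j hj).not.2 (by simpa using Ne.symm hne)
    rw [not_not] at h2
    apply h1
    rw [hlab i hi j hj hij, ← h2]
    exact congrArg h hij
  set f : X → Y := fun x =>
    if hx : ∃ i ∈ T, (z i).1 = x then (z hx.choose).2 else Classical.arbitrary Y with hf
  have hfz : ∀ i ∈ T, f (z i).1 = (z i).2 := by
    intro i hi
    have hx : ∃ j ∈ T, (z j).1 = (z i).1 := ⟨i, hi, rfl⟩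
    simp only [hf, dif_pos hx]
    exact hlab _ hx.choose_spec.1 _ hi hx.choose_spec.2
  have hA : Shatters (disagreement f '' H) (T.image fun i => (z i).1) := by
    intro b
    obtain ⟨h, hh, hhi⟩ := hpat (T.filter fun i => b (z i).1 = 1) (Finset.filter_subset _ _)
    refine ⟨_, ⟨h, hh, rfl⟩, fun x hx => ?_⟩
    obtain ⟨i, hi, rfl⟩ := Finset.mem_image.1 hx
    have h1 := hhi i hi
    rw [Finset.mem_filter] at h1
    simp only [disagreement, hfz i hi]
    by_cases h2 : h (z i).1 = (z i).2
    · rw [if_pos h2]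
      have : ¬b (z i).1 = 1 := fun h3 => h1.2 ⟨hi, h3⟩ h2
      omega
    · rw [if_neg h2]
      exact (h1.1 h2).2.symm
  have := card_le_graphDim hA
  rwa [Finset.card_image_of_injOn hinj] at this

/-- Sums of binomial coefficients are bounded by a weighted binomial expansion, since
`l ^ d ≤ l ^ i` for `i ≤ d`. -/
theorem pow_mul_sum_choose_le (n d : ℕ) {l : ℝ} (hl : 0 < l) (hl1 : l ≤ 1) :
    l ^ d * ∑ i ∈ Finset.Iic d, (n.choose i : ℝ) ≤ (1 + l) ^ n := by
  rw [Finset.mul_sum, add_comm, add_pow]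
  calc ∑ i ∈ Finset.Iic d, l ^ d * (n.choose i : ℝ)
      ≤ ∑ i ∈ Finset.Iic d, l ^ i * 1 ^ (n - i) * (n.choose i : ℝ) := by
        refine Finset.sum_le_sum fun i hi => ?_
        rw [one_pow, mul_one]
        exact mul_le_mul_of_nonneg_right
          (pow_le_pow_of_le_one hl.le hl1 (Finset.mem_Iic.1 hi)) (by positivity)
    _ ≤ _ := by
        rw [← Finset.sum_subset (Finset.inter_subset_left (s₂ := Finset.range (n + 1)))]
        · exact Finset.sum_le_sum_of_subset_of_nonneg Finset.inter_subset_right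
            fun i _ _ => by positivity
        · intro i h1 h2
          have h3 : n < i := by
            by_contra hcon
            exact h2 (Finset.mem_inter.2 ⟨h1, Finset.mem_range.2 (by omega)⟩)
          rw [Nat.choose_eq_zero_of_lt h3]
          simp

/-- The Sauer–Shelah lemma, with the sum of binomial coefficients bounded by a generating
function. -/
theorem pow_mul_card_errorPatterns_le {ι : Type*} [Fintype ι] [Nonempty Y]
    {H : Set (X → Y)} (z : ι → X × Y) {d : ℕ} (hd : graphDim H ≤ d) {l : ℝ} (hl : 0 < l)
    (hl1 : l ≤ 1) :
    l ^ d * ((errorPatterns H z).card : ℝ) ≤ (1 + l) ^ Fintype.card ι := by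
  classical
  have h1 := (errorPatterns H z).card_le_card_shatterer.trans Finset.card_shatterer_le_sum_vcDim
  have h2 : (errorPatterns H z).vcDim ≤ d := by
    refine Finset.sup_le fun T hT => ?_
    exact_mod_cast (card_le_of_shatters_errorPatterns (Finset.mem_shatterer.1 hT)).trans hd
  have h3 : (errorPatterns H z).card ≤ ∑ i ∈ Finset.Iic d, (Fintype.card ι).choose i :=
    h1.trans (Finset.sum_le_sum_of_subset (Finset.Iic_subset_Iic.2 h2))
  have h4 : ((errorPatterns H z).card : ℝ) ≤
      ∑ i ∈ Finset.Iic d, ((Fintype.card ι).choose i : ℝ) := by exact_mod_cast h3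
  exact (mul_le_mul_of_nonneg_left h4 (by positivity)).trans (pow_mul_sum_choose_le _ _ hl hl1)

/-- Exchange the `i`-th examples of the two samples for all `i` with `σ i`. -/
def swapAt {Z : Type*} {m : ℕ} (σ : Fin m → Bool) (P : (Fin m → Z) × (Fin m → Z)) :
    (Fin m → Z) × (Fin m → Z) :=
  (fun i => if σ i then P.2 i else P.1 i, fun i => if σ i then P.1 i else P.2 i)

theorem measurePreserving_swapAt {Z : Type*} [MeasurableSpace Z] (D : Measure Z)
    [IsProbabilityMeasure D] {m : ℕ} (σ : Fin m → Bool) :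
    MeasurePreserving (swapAt (Z := Z) σ)
      ((Measure.pi fun _ : Fin m => D).prod (Measure.pi fun _ : Fin m => D))
      ((Measure.pi fun _ : Fin m => D).prod (Measure.pi fun _ : Fin m => D)) := by
  have h1 := measurePreserving_arrowProdEquivProdArrow Z Z (Fin m) (fun _ => D) (fun _ => D)
  have h2 : MeasurePreserving (fun (p : Fin m → Z × Z) i =>
      (if σ i then Prod.swap else id) (p i))
      (Measure.pi fun _ => D.prod D) (Measure.pi fun _ => D.prod D) := by
    refine measurePreserving_pi _ _ fun i => ?_
    by_cases hi : σ i
    · simp only [hi, if_true]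
      exact Measure.measurePreserving_swap
    · simp only [hi]
      exact MeasurePreserving.id _
  have h3 := (h1.comp h2).comp (h1.symm _)
  convert h3 using 1
  funext P
  ext i
  · by_cases hi : σ i <;>
      simp [swapAt, hi, MeasurableEquiv.arrowProdEquivProdArrow, Equiv.arrowProdEquivProdArrow]
  · by_cases hi : σ i <;>
      simp [swapAt, hi, MeasurableEquiv.arrowProdEquivProdArrow, Equiv.arrowProdEquivProdArrow]

theorem empiricalRisk_swapAt_sub {m : ℕ} (σ : Fin m → Bool)
    (P : (Fin m → X × Y) × (Fin m → X × Y)) (h : X → Y) :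
    empiricalRisk (swapAt σ P).1 h - empiricalRisk (swapAt σ P).2 h =
      (1 / m) * ∑ i, boolSign (σ i) * (zeroOneLoss h (P.1 i) - zeroOneLoss h (P.2 i)) := by
  unfold empiricalRisk
  rw [← mul_sub, ← Finset.sum_sub_distrib]
  congr 1
  refine Finset.sum_congr rfl fun i _ => ?_
  by_cases hi : σ i <;> simp [swapAt, boolSign, hi]

/-- For a fixed pair of samples, few ways of swapping let the empirical risks of some hypothesis
deviate: a union bound over the error patterns on the `2 * m` examples. -/
theorem card_swapAt_deviation_le {H : Set (X → Y)} {m : ℕ} (hm : 0 < m) {t : ℝ} (ht : 0 ≤ t)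
    (P : (Fin m → X × Y) × (Fin m → X × Y)) (G : Finset (Fin m → Bool))
    (hG : ∀ σ ∈ G, ∃ h ∈ H, t <
      |empiricalRisk (swapAt σ P).1 h - empiricalRisk (swapAt σ P).2 h|) :
    (G.card : ℝ) ≤ (errorPatterns H (Sum.elim P.1 P.2)).card *
      (2 * (2 ^ m * Real.exp (-(m * t ^ 2 / 2)))) := by
  classical
  have hm' : (0 : ℝ) < m := by exact_mod_cast hm
  set a : Finset (Fin m ⊕ Fin m) → Fin m → ℝ := fun T i =>
    (if Sum.inl i ∈ T then 1 else 0) - (if Sum.inr i ∈ T then 1 else 0) with ha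
  have ha1 : ∀ T i, |a T i| ≤ 1 := by
    intro T i
    simp only [ha]
    split_ifs <;> norm_num
  have hsub : G ⊆ (errorPatterns H (Sum.elim P.1 P.2)).biUnion fun T =>
      Finset.univ.filter fun σ : Fin m → Bool => m * t < |∑ i, boolSign (σ i) * a T i| := by
    intro σ hσ
    obtain ⟨h, hh, hlt⟩ := hG σ hσ
    rw [Finset.mem_biUnion]
    refine ⟨Finset.univ.filter fun i => h (Sum.elim P.1 P.2 i).1 ≠ (Sum.elim P.1 P.2 i).2,
      mem_errorPatterns.2 ⟨h, hh, by simp⟩, ?_⟩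
    rw [Finset.mem_filter]
    refine ⟨Finset.mem_univ _, ?_⟩
    rw [empiricalRisk_swapAt_sub, abs_mul, abs_of_pos (by positivity : (0 : ℝ) < 1 / m),
      one_div_mul_eq_div, lt_div_iff₀ hm', mul_comm] at hlt
    refine hlt.trans_eq (congrArg abs (Finset.sum_congr rfl fun i _ => ?_))
    simp [ha, zeroOneLoss]
  have h1 := (Finset.card_le_card hsub).trans Finset.card_biUnion_le
  calc (G.card : ℝ) ≤ _ := Nat.cast_le.2 h1
    _ = ∑ T ∈ errorPatterns H (Sum.elim P.1 P.2), ((Finset.univ.filter fun σ : Fin m → Bool =>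
        m * t < |∑ i, boolSign (σ i) * a T i|).card : ℝ) := by push_cast; rfl
    _ ≤ ∑ _T ∈ errorPatterns H (Sum.elim P.1 P.2),
        2 * (2 ^ m * Real.exp (-(m * t ^ 2 / 2))) :=
      Finset.sum_le_sum fun T _ => card_lt_abs_rademacher_le _ (ha1 T) ht
    _ = _ := by simp

/-! ### The upper bound -/

section

variable [MeasurableSpace (X × Y)] {H : Set (X → Y)} {D : Measure (X × Y)}
  [IsProbabilityMeasure D]

instance (m : ℕ) : IsProbabilityMeasure (sampleLaw D m) := by
  unfold sampleLaw
  infer_instance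

/-- The pairs of samples on which the empirical risks of some hypothesis deviate. -/
def deviationSet (H : Set (X → Y)) (m : ℕ) (t : ℝ) : Set ((Fin m → X × Y) × (Fin m → X × Y)) :=
  {P | ∃ h ∈ H, t < |empiricalRisk P.1 h - empiricalRisk P.2 h|}

/-- Averaging over random swaps bounds the probability of a deviation between two samples. -/
theorem prod_deviationSet_le [Nonempty Y] (hD : WellBehaved H D) {d : ℕ}
    (hd : graphDim H ≤ d) {m : ℕ} (hm : 0 < m) {t : ℝ} (ht : 0 ≤ t) {l : ℝ} (hl : 0 < l)
    (hl1 : l ≤ 1) :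
    ((sampleLaw D m).prod (sampleLaw D m)) (deviationSet H m t) ≤
      ENNReal.ofReal (2 * ((l ^ d)⁻¹ * (1 + l) ^ (2 * m)) * Real.exp (-(m * t ^ 2 / 2))) := by
  classical
  set ν := (sampleLaw D m).prod (sampleLaw D m) with hν
  set E := deviationSet H m t with hE
  set K : ℝ := 2 * ((l ^ d)⁻¹ * (1 + l) ^ (2 * m)) * Real.exp (-(m * t ^ 2 / 2)) with hK
  have hEn : NullMeasurableSet E ν := hD.deviation m t
  have hmp : ∀ σ, MeasurePreserving (swapAt (Z := X × Y) σ) ν ν :=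
    fun σ => measurePreserving_swapAt D σ
  have hEσ : ∀ σ, NullMeasurableSet (swapAt σ ⁻¹' E) ν :=
    fun σ => hEn.preimage (hmp σ).quasiMeasurePreserving
  have hpt : ∀ P, ∑ σ : Fin m → Bool, (swapAt σ ⁻¹' E).indicator (fun _ => (1 : ENNReal)) P ≤
      ENNReal.ofReal (K * 2 ^ m) := by
    intro P
    have h1 : ∑ σ : Fin m → Bool, (swapAt σ ⁻¹' E).indicator (fun _ => (1 : ENNReal)) P =
        ((Finset.univ.filter fun σ : Fin m → Bool => swapAt σ P ∈ E).card : ENNReal) := by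
      rw [← Finset.sum_boole]
      exact Finset.sum_congr rfl fun σ _ => by simp [Set.indicator]
    rw [h1, ← ENNReal.ofReal_natCast]
    refine ENNReal.ofReal_le_ofReal ?_
    have h2 := card_swapAt_deviation_le (H := H) hm ht P
      (Finset.univ.filter fun σ : Fin m → Bool => swapAt σ P ∈ E)
      (fun σ hσ => (Finset.mem_filter.1 hσ).2)
    refine h2.trans ?_
    have h3 := pow_mul_card_errorPatterns_le (H := H) (Sum.elim P.1 P.2) hd hl hl1
    have h4 : ((errorPatterns H (Sum.elim P.1 P.2)).card : ℝ) ≤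
        (l ^ d)⁻¹ * (1 + l) ^ (2 * m) := by
      rw [inv_mul_eq_div, le_div_iff₀ (by positivity), mul_comm]
      simpa [two_mul] using h3
    calc _ ≤ (l ^ d)⁻¹ * (1 + l) ^ (2 * m) *
          (2 * (2 ^ m * Real.exp (-(m * t ^ 2 / 2)))) := by gcongr
      _ = K * 2 ^ m := by rw [hK]; ring
  have hsum : ∑ σ : Fin m → Bool, ν (swapAt σ ⁻¹' E) ≤ ENNReal.ofReal (K * 2 ^ m) := by
    calc ∑ σ : Fin m → Bool, ν (swapAt σ ⁻¹' E)
        = ∑ σ : Fin m → Bool, ∫⁻ P, (swapAt σ ⁻¹' E).indicator 1 P ∂ν :=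
          Finset.sum_congr rfl fun σ _ => (lintegral_indicator_one₀ (hEσ σ)).symm
      _ = ∫⁻ P, ∑ σ : Fin m → Bool, (swapAt σ ⁻¹' E).indicator 1 P ∂ν :=
          (lintegral_finsetSum' _ fun σ _ => aemeasurable_one.indicator₀ (hEσ σ)).symm
      _ ≤ ∫⁻ _P, ENNReal.ofReal (K * 2 ^ m) ∂ν := lintegral_mono hpt
      _ = _ := by simp
  have heq : ∑ σ : Fin m → Bool, ν (swapAt σ ⁻¹' E) = ν E * 2 ^ m := by
    rw [Finset.sum_congr rfl fun σ _ => (hmp σ).measure_preimage hEn]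
    simp [mul_comm]
  have hK0 : 0 ≤ K := by positivity
  rw [heq, ENNReal.ofReal_mul hK0, ENNReal.ofReal_pow (by norm_num)] at hsum
  rw [ENNReal.ofReal_ofNat] at hsum
  exact (ENNReal.mul_le_mul_iff_left (by simp) (by simp)).1 hsum

/-- Chebyshev's inequality for the empirical risk of one hypothesis. -/
theorem sampleLaw_abs_empiricalRisk_sub_risk_ge_le {h : X → Y}
    (hh : NullMeasurableSet {z : X × Y | h z.1 ≠ z.2} D) {m : ℕ} (hm : 0 < m) {t : ℝ}
    (ht : 0 < t) :
    sampleLaw D m {S | t ≤ |empiricalRisk S h - risk D h|} ≤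
      ENNReal.ofReal (1 / (4 * m * t ^ 2)) := by
  have hm' : (0 : ℝ) < m := by exact_mod_cast hm
  have hmeas := aestronglyMeasurable_zeroOneLoss hh
  have hL : MemLp (zeroOneLoss h) 2 D := by
    refine MemLp.of_bound hmeas 1 (Filter.Eventually.of_forall fun z => ?_)
    have := zeroOneLoss_mem_Icc h z
    rw [Real.norm_eq_abs, abs_of_nonneg this.1]
    exact this.2
  have hX : MemLp (fun z => (1 / (m : ℝ)) * zeroOneLoss h z) 2 D := hL.const_mul _
  have hcomp : ∀ i : Fin m, MemLp (fun S : Fin m → X × Y => (1 / (m : ℝ)) * zeroOneLoss h (S i)) 2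
      (sampleLaw D m) := fun i =>
    hX.comp_measurePreserving (measurePreserving_eval (fun _ : Fin m => D) i)
  have hemp : (fun S : Fin m → X × Y => empiricalRisk S h) =
      ∑ i, fun S : Fin m → X × Y => (1 / (m : ℝ)) * zeroOneLoss h (S i) := by
    funext S
    simp [empiricalRisk, Finset.mul_sum]
  have hLp : MemLp (fun S : Fin m → X × Y => empiricalRisk S h) 2 (sampleLaw D m) := by
    rw [hemp]
    exact memLp_finsetSum' _ fun i _ => hcomp i
  have hmean : ∫ S, empiricalRisk S h ∂sampleLaw D m = risk D h := by
    rw [hemp, Finset.sum_fn, integral_finsetSum _ fun i _ => (hcomp i).integrable (by norm_num)]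
    have h1 : ∀ i : Fin m, ∫ S, (1 / (m : ℝ)) * zeroOneLoss h (S i) ∂sampleLaw D m =
        (1 / m) * risk D h := by
      intro i
      rw [integral_const_mul]
      congr 1
      exact integral_comp_eval (μ := fun _ : Fin m => D) hmeas
    rw [Finset.sum_congr rfl fun i _ => h1 i]
    simp
    field_simp
  have hvar : ProbabilityTheory.variance (fun S => empiricalRisk S h) (sampleLaw D m) ≤
      1 / (4 * m) := by
    rw [hemp]
    have h1 := ProbabilityTheory.variance_sum_pi (μ := fun _ : Fin m => D)
      (X := fun _ z => (1 / (m : ℝ)) * zeroOneLoss h z) (fun _ => hX)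
    unfold sampleLaw
    rw [h1]
    have h2 : ProbabilityTheory.variance (fun z => (1 / (m : ℝ)) * zeroOneLoss h z) D ≤
        (1 / m) ^ 2 * (1 / 4) := by
      rw [ProbabilityTheory.variance_const_mul]
      gcongr
      have := ProbabilityTheory.variance_le_sq_of_bounded (μ := D) (a := 0) (b := 1)
        (Filter.Eventually.of_forall (zeroOneLoss_mem_Icc h)) hmeas.aemeasurable
      norm_num at this ⊢
      exact this
    calc _ ≤ ∑ _i : Fin m, (1 / (m : ℝ)) ^ 2 * (1 / 4) := Finset.sum_le_sum fun i _ => h2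
      _ = _ := by
        simp
        field_simp
  have h3 := ProbabilityTheory.meas_ge_le_variance_div_sq hLp ht
  rw [hmean] at h3
  refine h3.trans (ENNReal.ofReal_le_ofReal ?_)
  calc _ ≤ 1 / (4 * m) / t ^ 2 := by gcongr
    _ = _ := by field_simp

/-- Symmetrisation: a bad sample deviates from an independent one with probability at least
`1 / 2`. The bad event need not be measurable. -/
theorem sampleLaw_not_uniform_le (hD : WellBehaved H D) {m : ℕ} (hm : 0 < m) {ε : ℝ}
    (hε : 0 < ε) (hmε : 2 ≤ m * ε ^ 2) :
    sampleLaw D m {S | ¬ ∀ h ∈ H, |risk D h - empiricalRisk S h| ≤ ε} ≤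
      2 * ((sampleLaw D m).prod (sampleLaw D m)) (deviationSet H m (ε / 2)) := by
  set μ := sampleLaw D m with hμ
  -- a measurable superset of the same measure, to which Markov's inequality for sections applies
  set E := toMeasurable (μ.prod μ) (deviationSet H m (ε / 2)) with hE
  have hEm : MeasurableSet E := measurableSet_toMeasurable _ _
  have hsub : {S | ¬ ∀ h ∈ H, |risk D h - empiricalRisk S h| ≤ ε} ⊆
      {S | 2⁻¹ ≤ μ (Prod.mk S ⁻¹' E)} := by
    intro S hS
    simp only [Set.mem_ofPred_eq, not_forall, not_le] at hS
    obtain ⟨h, hh, hlt⟩ := hS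
    have h1 := sampleLaw_abs_empiricalRisk_sub_risk_ge_le (hD.loss h hh) hm (half_pos hε)
    set A := {S' : Fin m → X × Y | ε / 2 ≤ |empiricalRisk S' h - risk D h|} with hA
    have h2 : μ A ≤ 2⁻¹ := by
      refine h1.trans ?_
      have h3 : (2 : ENNReal)⁻¹ = ENNReal.ofReal (1 / 2) := by
        rw [one_div, ENNReal.ofReal_inv_of_pos (by norm_num)]
        simp
      rw [h3]
      refine ENNReal.ofReal_le_ofReal ?_
      refine one_div_le_one_div_of_le (by norm_num) ?_
      nlinarith
    have h4 : Aᶜ ⊆ Prod.mk S ⁻¹' E := by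
      intro S' hS'
      refine subset_toMeasurable _ _ ⟨h, hh, ?_⟩
      simp only [hA, Set.mem_compl_iff, Set.mem_ofPred_eq, not_le] at hS'
      have h5 := abs_sub_le (risk D h) (empiricalRisk S' h) (empiricalRisk S h)
      rw [abs_sub_comm (risk D h) (empiricalRisk S' h),
        abs_sub_comm (empiricalRisk S' h) (empiricalRisk S h)] at h5
      change ε / 2 < |empiricalRisk S h - empiricalRisk S' h|
      linarith
    have h6 : 1 ≤ μ A + μ Aᶜ := by
      rw [← measure_univ (μ := μ), ← Set.union_compl_self A]
      exact measure_union_le _ _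
    have h7 : (2 : ENNReal)⁻¹ + 2⁻¹ ≤ 2⁻¹ + μ Aᶜ := by
      rw [ENNReal.inv_two_add_inv_two]
      exact h6.trans (by gcongr)
    have h8 : (2 : ENNReal)⁻¹ ≤ μ Aᶜ :=
      (ENNReal.add_le_add_iff_left (by simp)).1 h7
    exact h8.trans (measure_mono h4)
  have h9 := mul_meas_ge_le_lintegral (μ := μ) (measurable_measure_prodMk_left (ν := μ) hEm) 2⁻¹
  rw [← Measure.prod_apply hEm, hE, measure_toMeasurable] at h9
  calc _ ≤ μ {S | 2⁻¹ ≤ μ (Prod.mk S ⁻¹' E)} := measure_mono hsub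
    _ = 2 * (2⁻¹ * μ {S | 2⁻¹ ≤ μ (Prod.mk S ⁻¹' E)}) := by
      rw [← mul_assoc, ENNReal.mul_inv_cancel (by simp) (by simp), one_mul]
    _ ≤ _ := by gcongr

end

/-- A sample size is sufficient once the exponential tail beats the number of patterns. -/
theorem isUCSampleSize_of_le [MeasurableSpace (X × Y)] [Nonempty Y] {H : Set (X → Y)} {d : ℕ}
    (hd : graphDim H ≤ d) {ε δ : ℝ} (hε : 0 < ε) (hε1 : ε ≤ 1) (hδ : 0 < δ) (N : ℕ)
    (hN2 : 2 ≤ N * ε ^ 2)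
    (hN : 16 * (Real.log 4 + d * Real.log (32 / ε ^ 2) + Real.log (1 / δ)) ≤ N * ε ^ 2) :
    IsUCSampleSize H ε δ N := by
  intro D _ hD m hm
  have hm' : (N : ℝ) ≤ m := by exact_mod_cast hm
  have hNm : N * ε ^ 2 ≤ m * ε ^ 2 := by gcongr
  have hm0 : 0 < m := by
    rcases Nat.eq_zero_or_pos m with h0 | h0
    · subst h0
      norm_num at hNm
      linarith
    · exact h0
  -- then `(1 + l) ^ (2 * m) ≤ exp (m * ε ^ 2 / 16)` costs half of Hoeffding's
  -- `exp (-m * ε ^ 2 / 8)`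
  set l : ℝ := ε ^ 2 / 32 with hl
  have hl0 : 0 < l := by positivity
  have hl1 : l ≤ 1 := by
    have : ε ^ 2 ≤ 1 := pow_le_one₀ hε.le hε1
    rw [hl]
    linarith
  refine (sampleLaw_not_uniform_le hD hm0 hε (hN2.trans hNm)).trans ?_
  have h1 := prod_deviationSet_le hD hd hm0 (half_pos hε).le hl0 hl1
  refine (mul_le_mul_right h1 2).trans ?_
  rw [← ENNReal.ofReal_ofNat, ← ENNReal.ofReal_mul (by norm_num)]
  refine ENNReal.ofReal_le_ofReal ?_
  have h2 : (l ^ d)⁻¹ = Real.exp (d * Real.log (32 / ε ^ 2)) := by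
    rw [← Real.log_pow, Real.exp_log (by positivity), ← inv_pow, hl, inv_div]
  have h3 : (1 + l) ^ (2 * m) ≤ Real.exp (m * ε ^ 2 / 16) := by
    calc (1 + l) ^ (2 * m) ≤ Real.exp l ^ (2 * m) := by
          gcongr
          linarith [Real.add_one_le_exp l]
      _ = _ := by
          rw [← Real.exp_nat_mul]
          congr 1
          rw [hl]
          push_cast
          ring
  have h4 : δ = Real.exp (-Real.log (1 / δ)) := by
    rw [one_div, Real.log_inv, neg_neg, Real.exp_log hδ]
  have h5 : (4 : ℝ) = Real.exp (Real.log 4) := (Real.exp_log (by norm_num)).symm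
  calc (2 : ℝ) * (2 * ((l ^ d)⁻¹ * (1 + l) ^ (2 * m)) * Real.exp (-(m * (ε / 2) ^ 2 / 2)))
      ≤ 2 * (2 * ((l ^ d)⁻¹ * Real.exp (m * ε ^ 2 / 16)) *
          Real.exp (-(m * (ε / 2) ^ 2 / 2))) := by gcongr
    _ = 4 * Real.exp (d * Real.log (32 / ε ^ 2)) * Real.exp (m * ε ^ 2 / 16) *
          Real.exp (-(m * (ε / 2) ^ 2 / 2)) := by rw [h2]; ring
    _ = Real.exp (Real.log 4 + d * Real.log (32 / ε ^ 2) + m * ε ^ 2 / 16 +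
          -(m * (ε / 2) ^ 2 / 2)) := by
        rw [Real.exp_add, Real.exp_add, Real.exp_add, ← h5]
    _ ≤ Real.exp (-Real.log (1 / δ)) := by
        refine Real.exp_le_exp.2 ?_
        nlinarith
    _ = δ := h4.symm

/-- The upper bound of order `(d * log (1 / ε) + log (1 / δ)) / ε ^ 2`. -/
theorem exists_isUCSampleSize_floor (c : ℝ) (hc0 : 0 < c) (hc1 : c < 1) :
    ∃ C : ℝ, 0 < C ∧ ∀ (X : Type*) (Y : Type*) [MeasurableSpace (X × Y)] [Nonempty Y]
      (H : Set (X → Y)) (d : ℕ), graphDim H ≤ d → ∀ ε δ : ℝ, 0 < ε → ε ≤ c → 0 < δ → δ ≤ c →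
      IsUCSampleSize H ε δ ⌊C * ((d * Real.log (1 / ε) + Real.log (1 / δ)) / ε ^ 2)⌋₊ := by
  set L := Real.log (1 / c) with hL
  have hL0 : 0 < L := Real.log_pos (by rw [lt_div_iff₀ hc0]; linarith)
  have h4 : (1 : ℝ) ≤ Real.log 4 := by
    rw [Real.le_log_iff_exp_le (by norm_num)]
    have := Real.exp_one_lt_d9
    linarith
  have h32 : (0 : ℝ) ≤ Real.log 32 := Real.log_nonneg (by norm_num)
  set C : ℝ := 16 * (Real.log 4 / L + Real.log 32 / L + 3) with hC
  have hC0 : 0 < C := by positivity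
  -- the factor `2` pays for rounding down
  refine ⟨2 * C, by positivity, ?_⟩
  intro X Y _ _ H d hd ε δ hε hεc hδ hδc
  have hLε : L ≤ Real.log (1 / ε) := Real.log_le_log (by positivity) (by gcongr)
  have hLδ : L ≤ Real.log (1 / δ) := Real.log_le_log (by positivity) (by gcongr)
  set a := Real.log (1 / ε) with ha
  set b := Real.log (1 / δ) with hb
  have ha0 : 0 < a := hL0.trans_le hLε
  have hb0 : 0 < b := hL0.trans_le hLδ
  set Q : ℝ := d * a + b with hQ
  have hQb : b ≤ Q := by
    rw [hQ]
    have : 0 ≤ d * a := by positivity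
    linarith
  have hQ0 : 0 < Q := hb0.trans_le hQb
  have hb4 : Real.log 4 ≤ Real.log 4 / L * b := by
    rw [div_mul_eq_mul_div, le_div_iff₀ hL0]
    gcongr
  have ha32 : Real.log 32 ≤ Real.log 32 / L * a := by
    rw [div_mul_eq_mul_div, le_div_iff₀ hL0]
    gcongr
  have hlog : Real.log (32 / ε ^ 2) = Real.log 32 + 2 * a := by
    rw [Real.log_div (by norm_num) (by positivity), Real.log_pow, ha, one_div, Real.log_inv]
    push_cast
    ring
  have hmain : 16 * (Real.log 4 + d * Real.log (32 / ε ^ 2) + b) ≤ C * Q := by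
    rw [hlog, hC, hQ]
    have h1 : d * (Real.log 32 + 2 * a) ≤ d * (Real.log 32 / L * a + 2 * a) := by gcongr
    have h2 : 0 ≤ Real.log 4 / L * (d * a) := by positivity
    have h3 : 0 ≤ Real.log 32 / L * b := by positivity
    have h5 : 0 ≤ d * a := by positivity
    nlinarith
  have hCQ : 16 ≤ C * Q := by
    refine le_trans ?_ hmain
    have : 0 ≤ d * Real.log (32 / ε ^ 2) := by
      rw [hlog]
      positivity
    linarith
  have hε1 : ε ≤ 1 := hεc.trans hc1.le
  have hε2 : ε ^ 2 ≤ 1 := pow_le_one₀ hε.le hε1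
  have hfloor : C * Q ≤ ⌊2 * C * (Q / ε ^ 2)⌋₊ * ε ^ 2 := by
    have h1 := Nat.lt_floor_add_one (2 * C * (Q / ε ^ 2))
    have h2 : 2 * C * (Q / ε ^ 2) * ε ^ 2 = 2 * (C * Q) := by field_simp
    have h3 : 2 * C * (Q / ε ^ 2) * ε ^ 2 ≤ (⌊2 * C * (Q / ε ^ 2)⌋₊ + 1) * ε ^ 2 := by gcongr
    rw [h2] at h3
    linarith
  exact isUCSampleSize_of_le hd hε hε1 hδ _ (by linarith) (hmain.trans hfloor)

theorem exists_shatters_lt_card {H : Set (X → Y)} {n : ℕ} (h : (n : ℕ∞) < graphDim H) :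
    ∃ (f : X → Y) (A : Finset X), Shatters (disagreement f '' H) A ∧ n < A.card := by
  obtain ⟨f, hf⟩ := lt_iSup_iff.1 h
  obtain ⟨A, hA⟩ := lt_iSup_iff.1 hf
  obtain ⟨hsh, hlt⟩ := lt_iSup_iff.1 hA
  exact ⟨f, A, hsh, by exact_mod_cast hlt⟩

/-- A finite graph dimension is attained; `H` has to be nonempty for `∅` to be shattered. -/
theorem exists_shatters_card_eq {H : Set (X → Y)} (hH : H.Nonempty) {d : ℕ}
    (h : graphDim H = d) :
    ∃ (f : X → Y) (A : Finset X), Shatters (disagreement f '' H) A ∧ A.card = d := by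
  rcases d with _ | d
  · obtain ⟨f, hf⟩ := hH
    exact ⟨f, ∅, fun _ => ⟨_, ⟨f, hf, rfl⟩, by simp⟩, rfl⟩
  · obtain ⟨f, A, hA, hlt⟩ := exists_shatters_lt_card (H := H) (n := d) (by
      rw [h]
      exact_mod_cast Nat.lt_succ_self d)
    have h2 := card_le_graphDim hA
    rw [h] at h2
    have h3 : A.card ≤ d + 1 := by exact_mod_cast h2
    exact ⟨f, A, hA, by omega⟩

end Multiclass

end

theorem theorem3p6 (c : ℝ) (hc0 : 0 < c) (hc1 : c < 1) :
    ∃ C₁ C₂ : ℝ, 0 < C₁ ∧ 0 < C₂ ∧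
      ∀ (X : Type*) (Y : Type*) [MeasurableSpace (X × Y)] [MeasurableSingletonClass (X × Y)]
        [Nonempty X] [Nontrivial Y] (H : Set (X → Y)), H.Nonempty →
        ∀ ε δ : ℝ, 0 < ε → ε ≤ c → 0 < δ → δ ≤ c →
          (∀ d : ℕ, Multiclass.graphDim H = d →
            ∃ n : ℕ, Multiclass.ucRate H ε δ = n ∧
              C₁ * (((d : ℝ) + Real.log (1 / δ) - C₁) / ε ^ 2) ≤ n ∧
              (n : ℝ) ≤ C₂ * (((d : ℝ) * Real.log (1 / ε) + Real.log (1 / δ)) / ε ^ 2)) ∧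
          (Multiclass.graphDim H = ⊤ → Multiclass.ucRate H ε δ = ⊤) := by
  classical
  obtain ⟨k₁, hk₁, hlow₁⟩ := Multiclass.exists_mul_log_div_sq_le c hc0 hc1
  obtain ⟨k₂, hk₂, hlow₂⟩ := Multiclass.exists_mul_card_div_sq_le c hc0 hc1
  obtain ⟨C₂, hC₂, hup⟩ := Multiclass.exists_isUCSampleSize_floor c hc0 hc1
  refine ⟨min k₁ k₂ / 2, C₂, by positivity, hC₂, ?_⟩
  intro X Y _ _ _ _ H hH ε δ hε hεc hδ hδc
  have hlogε : 0 < Real.log (1 / ε) := Real.log_pos (by rw [lt_div_iff₀ hε]; linarith)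
  have hlogδ : 0 < Real.log (1 / δ) := Real.log_pos (by rw [lt_div_iff₀ hδ]; linarith)
  constructor
  · intro d hd
    have hN := hup X Y H d hd.le ε δ hε hεc hδ hδc
    have hex : ∃ N, Multiclass.IsUCSampleSize H ε δ N := ⟨_, hN⟩
    refine ⟨Nat.find hex, ?_, ?_, ?_⟩
    · refine le_antisymm (iInf₂_le _ (Nat.find_spec hex)) (le_iInf₂ fun N hN => ?_)
      exact_mod_cast Nat.find_min' hex hN
    · have h1 := hlow₁ X Y H hH ε δ _ hε hεc hδ hδc (Nat.find_spec hex)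
      obtain ⟨f, A, hA, hAd⟩ := Multiclass.exists_shatters_card_eq hH hd
      have h2 := hlow₂ X Y H hH ε δ _ hε hεc hδ hδc (Nat.find_spec hex) f A hA
      rw [hAd] at h2
      set n : ℝ := ((Nat.find hex : ℕ) : ℝ)
      set k := min k₁ k₂ with hk
      have hk0 : 0 < k := by positivity
      have h3 : k * (Real.log (1 / δ) / ε ^ 2) ≤ n :=
        le_trans (by gcongr; exact min_le_left _ _) h1
      have h4 : k * (d / ε ^ 2) ≤ n := le_trans (by gcongr; exact min_le_right _ _) h2
      calc k / 2 * ((d + Real.log (1 / δ) - k / 2) / ε ^ 2)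
          ≤ k / 2 * ((d + Real.log (1 / δ)) / ε ^ 2) := by gcongr; linarith
        _ = (k * (d / ε ^ 2) + k * (Real.log (1 / δ) / ε ^ 2)) / 2 := by ring
        _ ≤ n := by linarith
    · exact (Nat.cast_le.2 (Nat.find_min' hex hN)).trans (Nat.floor_le (by positivity))
  · intro htop
    refine iInf₂_eq_top.2 fun N hN => ?_
    exfalso
    obtain ⟨M, hM⟩ := exists_nat_gt ((N : ℝ) / (1 - ε))
    obtain ⟨f, A, hA, hMA⟩ := Multiclass.exists_shatters_lt_card (H := H) (n := M)
      (by rw [htop]; exact ENat.natCast_lt_top M)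
    have h1 := hN.one_sub_mul_card_le hδ.le (hδc.trans_lt hc1) hA
    have h2 : (M : ℝ) < A.card := by exact_mod_cast hMA
    have h3 : 0 < 1 - ε := by linarith
    rw [div_lt_iff₀ h3] at hM
    nlinarith
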